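/- Let $g\in C^2(\mathbb R)$ be bounded and strictly increasing, with $g(0)=0$, strictly concave on $(0,+\infty)$ and strictly convex on $(-\infty,0)$; put $g_\pm=\lim_{s\to\pm\infty}g(s)$ and $G(s)=\int_0^s g$. A function $q\in L^\infty(\mathbb R)$ is said to have asymptotic average $A(q)$ if $\frac1T\int_t^{t+T}q(s)\,ds\to A(q)$ as $T\to+\infty$, uniformly in $t\in\mathbb R$. Let $p$ be bounded and continuous on $\mathbb R$ with asymptotic average $A(p)\in(g_-,g_+)$. For $q\in L^\infty(\mathbb R)$ and $\varepsilon>0$, an $\varepsilon$-decomposition of $q$ is an identity $q=q_1+\dot q_2$ (weak derivative) with $\|q_1-A(p)\|_\infty<\varepsilon/2$ and $q_2\in L^\infty(\mathbb R)$. Such a decomposition of $p$ exists for each $\varepsilon>0$; fix for every $\varepsilon\in(0,1)$ any one of them, $p=p_{1,\varepsilon}+\dot p_{2,\varepsilon}$, and let $\mathcal P$ be the set of all $q\in L^\infty(\mathbb R)$ such that $\|q\|_\infty<\|p\|_\infty+1$, $q$ has asymptotic average $A(q)=A(p)$, and for every $\varepsilon\in(0,1)$ there is an $\varepsilon$-decomposition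 $q=q_{1,\varepsilon}+\dot q_{2,\varepsilon}$ with $\|q_{2,\varepsilon}\|_\infty<\|p_{2,\varepsilon}\|_\infty+1$. For $a<b$ let $H^1_0(a,b)^+=\{u\in H^1_0(a,b):u\ge 0\}$ and $$J_{(a,b),q}(u)=\int_a^b\Big[\tfrac12\dot u(t)^2-G(u(t))+q(t)u(t)\Big]\,dt .$$ (i) There is $\tilde L>0$, which may be taken larger than any prescribed number and which does not depend on $a$, $b$, $q$, such that whenever $b-a\ge\tilde L$ and $q\in\mathcal P$, the functional $J_{(a,b),q}$ has exactly one minimizer $u$ in $H^1_0(a,b)^+$; moreover $u>0$ in $(a,b)$, and $u$ solves $$\ddot u(t)+g(u(t))=q(t)\ \text{ in }(a,b),\qquad u(a)=0=u(b),$$ in the sense that $u\in C^1([a,b])$, $\dot u$ is absolutely continuous on $[a,b]$ and the equation holds almost everywhere; if $q$ is continuous in $(a,b)$, then $u\in C^2(a,b)$ and the equation holds at every point of $(a,b)$. (ii) For every bounded interval $(a,b)$, $a<b$, any two minimizers $u,v$ of $J_{(a,b),p}$ in $H^1_0(a,b)^+$ that belong to $C^2(a,b)$ and are strictly positive in $(a,b)$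 coincide on $[a,b]$. -/

import Mathlib

open Set Filter Topology MeasureTheory

noncomputable section

namespace BVP

/-- Standing assumptions on the nonlinearity `g`. -/
structure AdmissibleNonlinearity (g : ℝ → ℝ) : Prop where
  zero : g 0 = 0
  contDiff : ContDiff ℝ 2 g
  bounded : ∃ C : ℝ, ∀ s, |g s| ≤ C
  strictMono : StrictMono g
  strictConcave : StrictConcaveOn ℝ (Ioi 0) g
  strictConvex : StrictConvexOn ℝ (Iio 0) g

/-- `p` has asymptotic average `A`: the means of `p` over `(t, t + T)` converge to `A` as
`T → +∞`, uniformly in `t`. -/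
def HasAsymptoticAverage (p : ℝ → ℝ) (A : ℝ) : Prop :=
  ∀ ε > 0, ∃ T₀ > 0, ∀ T > T₀, ∀ t : ℝ, |(1 / T) * (∫ s in t..(t + T), p s) - A| < ε

/-- Standing assumptions on the forcing term `p`: bounded and continuous, with an asymptotic
average `A` strictly between the limits `gm`, `gp` of the nonlinearity. -/
structure AdmissibleForcing (gm gp : ℝ) (p : ℝ → ℝ) (A : ℝ) : Prop where
  continuous : Continuous p
  bounded : ∃ C : ℝ, ∀ t, |p t| ≤ C
  average : HasAsymptoticAverage p A
  lower : gm < A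
  upper : A < gp

/-- A decomposition `q = q₁ + q₂'` at level `ε` with respect to `A`:
`‖q₁ - A‖_∞ < ε / 2`, `q₂ ∈ L^∞(ℝ)`, and `q₂` is a primitive of `q - q₁`. (For `q ∈ L^∞(ℝ)` the
weak derivative `q₂' = q - q₁` is bounded; `q₂` is its Lipschitz continuous representative.) -/
structure IsDecomposition (q : ℝ → ℝ) (A ε : ℝ) (q₁ q₂ : ℝ → ℝ) : Prop where
  measurable_fst : AEStronglyMeasurable q₁ volume
  norm_fst : eLpNorm (fun t => q₁ t - A) ⊤ volume < ENNReal.ofReal (ε / 2)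
  memLp_snd : MemLp q₂ ⊤ volume
  primitive : ∀ s t : ℝ, q₂ t - q₂ s = ∫ x in s..t, (q x - q₁ x)

/-- The class `𝒫` attached to `p`, to its asymptotic average `A` and to the family
`(p₂ ε)`, `0 < ε < 1`, of bounded primitives in the decompositions chosen for `p`:
all `q ∈ L^∞(ℝ)` with `‖q‖_∞ < ‖p‖_∞ + 1`, with asymptotic average `A`, and such that for each
`ε ∈ (0, 1)` there is a decomposition `q = q₁ + q₂'` with `‖q₂‖_∞ < ‖p₂ ε‖_∞ + 1`. -/
def classP (p : ℝ → ℝ) (A : ℝ) (p₂ : ℝ → ℝ → ℝ) : Set (ℝ → ℝ) :=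
  {q | MemLp q ⊤ volume ∧
    eLpNorm q ⊤ volume < eLpNorm p ⊤ volume + 1 ∧
    HasAsymptoticAverage q A ∧
    ∀ ε ∈ Ioo (0 : ℝ) 1, ∃ q₁ q₂ : ℝ → ℝ, IsDecomposition q A ε q₁ q₂ ∧
      eLpNorm q₂ ⊤ volume < eLpNorm (p₂ ε) ⊤ volume + 1}

/-- The space `H¹₀(a, b)` on a bounded interval: absolutely continuous functions on `[a, b]` with
square integrable derivative that vanish at `a` and `b`. Only the values on `[a, b]` matter. -/
def H10 (a b : ℝ) : Set (ℝ → ℝ) :=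
  {u | AbsolutelyContinuousOnInterval u a b ∧
    MemLp (deriv u) 2 (volume.restrict (Ioo a b)) ∧ u a = 0 ∧ u b = 0}

/-- The nonnegative functions in `H¹₀(a, b)`. -/
def H10plus (a b : ℝ) : Set (ℝ → ℝ) :=
  {u | u ∈ H10 a b ∧ ∀ t ∈ Icc a b, 0 ≤ u t}

/-- The primitive of `g` vanishing at `0`. -/
def primitiveG (g : ℝ → ℝ) (s : ℝ) : ℝ := ∫ x in (0 : ℝ)..s, g x

/-- The action functional `J_{(a,b),q}(u) = ∫_a^b (u'² / 2 - G(u) + q u)`. -/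
def action (g q : ℝ → ℝ) (a b : ℝ) (u : ℝ → ℝ) : ℝ :=
  ∫ t in a..b, ((1 / 2) * deriv u t ^ 2 - primitiveG g (u t) + q t * u t)

/-- `u` minimizes the action over the nonnegative functions in `H¹₀(a, b)`. -/
def IsMinimizer (g q : ℝ → ℝ) (a b : ℝ) (u : ℝ → ℝ) : Prop :=
  u ∈ H10plus a b ∧ IsMinOn (action g q a b) (H10plus a b) u

/-- `u` solves `u'' + g(u) = q` in `(a, b)`, `u(a) = 0 = u(b)`, `u > 0` in `(a, b)`, for
`q ∈ L^∞`: `u` is `C¹` on `[a, b]`, its derivative `w` is absolutely continuous on `[a, b]`, and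
the equation holds almost everywhere. -/
def SolvesDirichlet (g q : ℝ → ℝ) (a b : ℝ) (u : ℝ → ℝ) : Prop :=
  (∃ w : ℝ → ℝ, AbsolutelyContinuousOnInterval w a b ∧
      (∀ t ∈ Icc a b, HasDerivWithinAt u (w t) (Icc a b) t) ∧
      ∀ᵐ t ∂(volume.restrict (Ioo a b)), HasDerivAt w (q t - g (u t)) t) ∧
    u a = 0 ∧ u b = 0 ∧ ∀ t ∈ Ioo a b, 0 < u t

/-- `u` is a classical solution of the same problem: `u ∈ C²(a, b) ∩ C[a, b]` and the equation
holds at each point of `(a, b)`. -/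
def SolvesDirichletClassically (g q : ℝ → ℝ) (a b : ℝ) (u : ℝ → ℝ) : Prop :=
  ContDiffOn ℝ 2 u (Ioo a b) ∧ ContinuousOn u (Icc a b) ∧
    (∀ t ∈ Ioo a b, deriv (deriv u) t + g (u t) = q t) ∧
    u a = 0 ∧ u b = 0 ∧ ∀ t ∈ Ioo a b, 0 < u t

/-- Decompositions of a bounded continuous `p` with asymptotic average exist at each level, so the
families used to form the class `𝒫` exist. -/
theorem exists_decomposition {p : ℝ → ℝ} {A : ℝ} (hc : Continuous p)
    (hb : ∃ C : ℝ, ∀ t, |p t| ≤ C) (ha : HasAsymptoticAverage p A) {ε : ℝ} (hε : 0 < ε) :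
    ∃ p₁ p₂ : ℝ → ℝ, IsDecomposition p A ε p₁ p₂ := by
  obtain ⟨C, hC⟩ := hb
  obtain ⟨T₀, hT₀, hT⟩ := ha (ε / 4) (by positivity)
  set T := T₀ + 1 with hTdef
  have hTpos : 0 < T := by positivity
  set P : ℝ → ℝ := fun t => ∫ s in (0 : ℝ)..t, p s with hP
  have hPd : ∀ t, HasDerivAt P (p t) t := fun t => hc.integral_hasStrictDerivAt 0 t |>.hasDerivAt
  have hPc : Continuous P := continuous_iff_continuousAt.2 fun t => (hPd t).continuousAt
  set Q : ℝ → ℝ := fun t => ∫ s in (0 : ℝ)..t, P s with hQ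
  have hQd : ∀ t, HasDerivAt Q (P t) t := fun t => hPc.integral_hasStrictDerivAt 0 t |>.hasDerivAt
  have hQc : Continuous Q := continuous_iff_continuousAt.2 fun t => (hQd t).continuousAt
  have hPsub : ∀ s t, P t - P s = ∫ x in s..t, p x := fun s t =>
    (intervalIntegral.integral_eq_sub_of_hasDerivAt (fun x _ => hPd x)
      (hc.intervalIntegrable _ _)).symm
  have hQsub : ∀ s t, Q t - Q s = ∫ x in s..t, P x := fun s t =>
    (intervalIntegral.integral_eq_sub_of_hasDerivAt (fun x _ => hQd x)
      (hPc.intervalIntegrable _ _)).symm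
  set p₁ : ℝ → ℝ := fun t => (1 / T) * (P (t + T) - P t) with hp₁
  set p₂ : ℝ → ℝ := fun t => P t - (1 / T) * (Q (t + T) - Q t) with hp₂
  have hp₁c : Continuous p₁ := by fun_prop
  have hp₂c : Continuous p₂ := by fun_prop
  refine ⟨p₁, p₂, hp₁c.aestronglyMeasurable, ?_, ?_, ?_⟩
  · refine lt_of_le_of_lt (b := ENNReal.ofReal (ε / 4)) ?_
      ((ENNReal.ofReal_lt_ofReal_iff (by positivity)).2 (by linarith))
    rw [eLpNorm_exponent_top]
    refine eLpNormEssSup_le_of_ae_bound (Eventually.of_forall fun t => ?_)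
    rw [Real.norm_eq_abs, hp₁]
    simp only [hPsub]
    exact (hT T (by linarith) t).le
  · refine memLp_top_of_bound hp₂c.aestronglyMeasurable (C * T) (Eventually.of_forall fun t => ?_)
    have hC0 : 0 ≤ C := (abs_nonneg _).trans (hC 0)
    have hb : ∀ s t, |P t - P s| ≤ C * |t - s| := fun s t => by
      rw [hPsub, ← Real.norm_eq_abs]
      exact intervalIntegral.norm_integral_le_of_norm_le_const fun x _ => hC x
    have h1 : p₂ t = (1 / T) * ∫ x in t..(t + T), (P t - P x) := by
      rw [intervalIntegral.integral_sub (by simp) (hPc.intervalIntegrable _ _), ← hQsub]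
      simp only [hp₂, intervalIntegral.integral_const, smul_eq_mul]
      field_simp
      ring
    have h2 : |∫ x in t..(t + T), (P t - P x)| ≤ (C * T) * |t + T - t| := by
      rw [← Real.norm_eq_abs]
      refine intervalIntegral.norm_integral_le_of_norm_le_const fun x hx => ?_
      rw [uIoc_of_le (by linarith)] at hx
      refine (hb x t).trans (mul_le_mul_of_nonneg_left ?_ hC0)
      rw [abs_le]
      constructor <;> linarith [hx.1, hx.2]
    rw [add_sub_cancel_left, abs_of_pos hTpos] at h2
    rw [h1, Real.norm_eq_abs, abs_mul, abs_of_pos (by positivity : 0 < 1 / T)]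
    calc 1 / T * |∫ x in t..(t + T), (P t - P x)| ≤ 1 / T * (C * T * T) :=
          mul_le_mul_of_nonneg_left h2 (by positivity)
      _ = C * T := by field_simp
  · intro s t
    refine (intervalIntegral.integral_eq_sub_of_hasDerivAt (f := p₂) (fun x _ => ?_)
      ((hc.sub hp₁c).intervalIntegrable _ _)).symm
    have h := (hPd x).sub ((((hQd (x + T)).comp_add_const x T).sub (hQd x)).const_mul (1 / T))
    exact h

end BVP

end

/-!
Upward variations show that a minimizer `u` satisfies `u'' ≤ q - g(u)` weakly, with equality where
`u > 0`. Fix a level `R` such that `g(R)` exceeds the upper mean of `q`. Where `u ≥ R` the slope of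
`u` decays at a definite rate, so a zero of `u` inside `(a, b)` bounds `u` on both sides of it,
independently of the length of the interval. On a long interval, however, adding a tall tent
function to a bounded `u` lowers the action. Hence minimizers on long intervals are strictly
positive and solve the Euler-Lagrange equation.

For uniqueness, the maximum of two minimizers is again a minimizer, so it suffices to compare
positive minimizers `u ≤ v`. Using each as a test function in the equation of the other turns the
difference of their actions into the integral of the error of the trapezoidal rule for `∫ g` over
`[u(t), v(t)]`, which is positive by strict concavity of `g` wherever `u(t) < v(t)`.

Existence is the direct method in the variable `u'`: the action is `‖u'‖² / 2` plus a Lipschitz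
function of the primitive of `u'`, and taking primitives is a compact operator on `L²`.
-/

noncomputable section

namespace BVP

section AbsolutelyContinuous

variable {f h : ℝ → ℝ} {a b t : ℝ}

lemma absolutelyContinuousOnInterval_max (hf : AbsolutelyContinuousOnInterval f a b)
    (hh : AbsolutelyContinuousOnInterval h a b) :
    AbsolutelyContinuousOnInterval (fun t => max (f t) (h t)) a b := by
  refine squeeze_zero (fun E => Finset.sum_nonneg fun i _ => dist_nonneg) (fun E => ?_)
    (by simpa only [add_zero] using Tendsto.add hf hh)
  rw [← Finset.sum_add_distrib]
  refine Finset.sum_le_sum fun i _ => ?_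
  simp only [Real.dist_eq]
  exact (abs_max_sub_max_le_max _ _ _ _).trans
    (max_le_add_of_nonneg (abs_nonneg _) (abs_nonneg _))

lemma ae_differentiableAt_Icc (hab : a ≤ b) (hf : AbsolutelyContinuousOnInterval f a b) :
    ∀ᵐ t, t ∈ Icc a b → DifferentiableAt ℝ f t := by
  simpa only [uIcc_of_le hab] using hf.ae_differentiableAt

lemma deriv_eq_of_le_of_eq (hf : DifferentiableAt ℝ f t) (hh : DifferentiableAt ℝ h t)
    (hle : ∀ s, h s ≤ f s) (heq : f t = h t) : deriv f t = deriv h t := by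
  have hmin : IsLocalMin (fun s => f s - h s) t :=
    Eventually.of_forall fun s => by simpa only [heq, sub_self, sub_nonneg] using hle s
  have hderiv := hmin.deriv_eq_zero
  rw [deriv_fun_sub hf hh] at hderiv
  exact sub_eq_zero.1 hderiv

lemma ae_deriv_add (hab : a ≤ b) (hf : AbsolutelyContinuousOnInterval f a b)
    (hh : AbsolutelyContinuousOnInterval h a b) :
    ∀ᵐ t, t ∈ Icc a b → deriv (fun s => f s + h s) t = deriv f t + deriv h t := by
  filter_upwards [ae_differentiableAt_Icc hab hf, ae_differentiableAt_Icc hab hh] with t df dh ht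
  exact deriv_fun_add (df ht) (dh ht)

lemma ae_deriv_sub (hab : a ≤ b) (hf : AbsolutelyContinuousOnInterval f a b)
    (hh : AbsolutelyContinuousOnInterval h a b) :
    ∀ᵐ t, t ∈ Icc a b → deriv (fun s => f s - h s) t = deriv f t - deriv h t := by
  filter_upwards [ae_differentiableAt_Icc hab hf, ae_differentiableAt_Icc hab hh] with t df dh ht
  exact deriv_fun_sub (df ht) (dh ht)

lemma ae_deriv_max_min (hab : a ≤ b) (hf : AbsolutelyContinuousOnInterval f a b)
    (hh : AbsolutelyContinuousOnInterval h a b) :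
    ∀ᵐ t, t ∈ Icc a b →
      (h t ≤ f t ∧ deriv (fun s => max (f s) (h s)) t = deriv f t ∧
        deriv (fun s => min (f s) (h s)) t = deriv h t) ∨
      (f t ≤ h t ∧ deriv (fun s => max (f s) (h s)) t = deriv h t ∧
        deriv (fun s => min (f s) (h s)) t = deriv f t) := by
  filter_upwards [ae_differentiableAt_Icc hab hf, ae_differentiableAt_Icc hab hh,
    ae_differentiableAt_Icc hab (absolutelyContinuousOnInterval_max hf hh)] with t df dh dmax ht
  have hmin : deriv (fun s => min (f s) (h s)) t =
      deriv f t + deriv h t - deriv (fun s => max (f s) (h s)) t := by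
    rw [← deriv_fun_add (df ht) (dh ht), ← deriv_fun_sub ((df ht).fun_add (dh ht)) (dmax ht)]
    exact congrArg (deriv · t) (funext fun s => eq_sub_of_add_eq (min_add_max _ _))
  rcases le_total (h t) (f t) with hle | hle
  · have hmax := deriv_eq_of_le_of_eq (dmax ht) (df ht) (fun s => le_max_left _ _)
      (max_eq_left hle)
    exact Or.inl ⟨hle, hmax, by rw [hmin, hmax]; ring⟩
  · have hmax := deriv_eq_of_le_of_eq (dmax ht) (dh ht) (fun s => le_max_right _ _)
      (max_eq_right hle)
    exact Or.inr ⟨hle, hmax, by rw [hmin, hmax]; ring⟩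

lemma ae_restrict_Ioo_of_ae_Icc {P : ℝ → Prop} (hP : ∀ᵐ t, t ∈ Icc a b → P t) :
    ∀ᵐ t ∂(volume.restrict (Ioo a b)), P t := by
  rw [ae_restrict_iff' measurableSet_Ioo]
  filter_upwards [hP] with t ht hmem
  exact ht (Ioo_subset_Icc_self hmem)

lemma integral_congr_ae_Icc (hab : a ≤ b) (hfh : ∀ᵐ t, t ∈ Icc a b → f t = h t) :
    ∫ t in a..b, f t = ∫ t in a..b, h t := by
  refine intervalIntegral.integral_congr_ae ?_
  filter_upwards [hfh] with t ht hmem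
  rw [uIoc_of_le hab] at hmem
  exact ht (Ioc_subset_Icc_self hmem)

lemma intervalIntegrable_of_continuousOn_Icc (hab : a ≤ b) (hf : ContinuousOn f (Icc a b)) :
    IntervalIntegrable f volume a b :=
  ContinuousOn.intervalIntegrable (by rwa [uIcc_of_le hab])

lemma intervalIntegrable_mul_continuousOn (hab : a ≤ b) (hf : IntervalIntegrable f volume a b)
    (hh : ContinuousOn h (Icc a b)) : IntervalIntegrable (fun t => f t * h t) volume a b :=
  hf.mul_continuousOn (by rwa [uIcc_of_le hab])

end AbsolutelyContinuous

namespace H10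

variable {u v : ℝ → ℝ} {a b : ℝ}

lemma continuousOn (hab : a ≤ b) (hu : u ∈ H10 a b) : ContinuousOn u (Icc a b) := by
  simpa only [uIcc_of_le hab] using hu.1.continuousOn

lemma intervalIntegrable_deriv_mul_deriv (hab : a ≤ b) (hu : u ∈ H10 a b) (hv : v ∈ H10 a b) :
    IntervalIntegrable (fun t => deriv u t * deriv v t) volume a b := by
  rw [intervalIntegrable_iff_integrableOn_Ioo_of_le hab]
  exact MemLp.integrable_mul hu.2.1 hv.2.1

lemma intervalIntegrable_deriv_sq (hab : a ≤ b) (hu : u ∈ H10 a b) :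
    IntervalIntegrable (fun t => deriv u t ^ 2) volume a b := by
  simpa only [sq] using intervalIntegrable_deriv_mul_deriv hab hu hu

lemma add_mem (hab : a ≤ b) (hu : u ∈ H10 a b) (hv : v ∈ H10 a b) :
    (fun t => u t + v t) ∈ H10 a b := by
  refine ⟨hu.1.add hv.1, (hu.2.1.add hv.2.1).ae_eq ?_, by simp [hu.2.2.1, hv.2.2.1],
    by simp [hu.2.2.2, hv.2.2.2]⟩
  filter_upwards [ae_restrict_Ioo_of_ae_Icc (ae_deriv_add hab hu.1 hv.1)] with t ht
  exact ht.symm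

lemma const_mul_mem (hu : u ∈ H10 a b) (c : ℝ) : (fun t => c * u t) ∈ H10 a b := by
  refine ⟨hu.1.const_mul c, ?_, by simp [hu.2.2.1], by simp [hu.2.2.2]⟩
  have hderiv : deriv (fun t => c * u t) = fun t => c * deriv u t :=
    funext fun t => deriv_const_mul_field c
  rw [hderiv]
  exact hu.2.1.const_mul c

lemma neg_mem (hu : u ∈ H10 a b) : (fun t => -u t) ∈ H10 a b := by
  simpa only [neg_one_mul] using const_mul_mem hu (-1)

lemma sub_mem (hab : a ≤ b) (hu : u ∈ H10 a b) (hv : v ∈ H10 a b) :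
    (fun t => u t - v t) ∈ H10 a b := by
  simpa only [sub_eq_add_neg] using add_mem hab hu (neg_mem hv)

lemma max_mem (hab : a ≤ b) (hu : u ∈ H10 a b) (hv : v ∈ H10 a b) :
    (fun t => max (u t) (v t)) ∈ H10 a b := by
  refine ⟨absolutelyContinuousOnInterval_max hu.1 hv.1, ?_, by simp [hu.2.2.1, hv.2.2.1],
    by simp [hu.2.2.2, hv.2.2.2]⟩
  refine (hu.2.1.norm.add hv.2.1.norm).mono (measurable_deriv _).aestronglyMeasurable ?_
  filter_upwards [ae_restrict_Ioo_of_ae_Icc (ae_deriv_max_min hab hu.1 hv.1)] with t ht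
  have hsum_nonneg := add_nonneg (norm_nonneg (deriv u t)) (norm_nonneg (deriv v t))
  rw [Pi.add_apply, Real.norm_of_nonneg hsum_nonneg]
  rcases ht with ⟨-, hderiv, -⟩ | ⟨-, hderiv, -⟩ <;> rw [hderiv]
  · exact le_add_of_nonneg_right (norm_nonneg _)
  · exact le_add_of_nonneg_left (norm_nonneg _)

lemma min_mem (hab : a ≤ b) (hu : u ∈ H10 a b) (hv : v ∈ H10 a b) :
    (fun t => min (u t) (v t)) ∈ H10 a b := by
  have hmin : (fun t => min (u t) (v t)) = fun t => u t + v t - max (u t) (v t) :=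
    funext fun t => eq_sub_of_add_eq (min_add_max _ _)
  rw [hmin]
  exact sub_mem hab (add_mem hab hu hv) (max_mem hab hu hv)

lemma mem_of_lipschitzWith {K : NNReal} (hu : LipschitzWith K u) (ha : u a = 0)
    (hb : u b = 0) : u ∈ H10 a b :=
  ⟨hu.lipschitzOnWith.absolutelyContinuousOnInterval,
    MemLp.of_bound (measurable_deriv u).aestronglyMeasurable K
      (Eventually.of_forall fun _ => norm_deriv_le_of_lipschitz hu), ha, hb⟩

lemma integral_mul_eq_neg_integral_mul_deriv {h : ℝ → ℝ} (hab : a ≤ b) (hu : u ∈ H10 a b)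
    (hh : IntervalIntegrable h volume a b) (c : ℝ) :
    ∫ t in a..b, h t * u t = -∫ t in a..b, (c + ∫ s in a..t, h s) * deriv u t := by
  set H : ℝ → ℝ := fun t => c + ∫ s in a..t, h s
  have hac : AbsolutelyContinuousOnInterval H a b :=
    (LipschitzWith.const c).lipschitzOnWith.absolutelyContinuousOnInterval.add
      (hh.absolutelyContinuousOnInterval_intervalIntegral (c := a) left_mem_uIcc)
  have hderiv : ∫ t in a..b, deriv H t * u t = ∫ t in a..b, h t * u t := by
    refine integral_congr_ae_Icc hab ?_
    filter_upwards [hh.ae_hasDerivAt_integral] with t ht hmem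
    rw [uIcc_of_le hab] at ht
    rw [((ht hmem a (left_mem_Icc.2 hab)).const_add c).deriv]
  have hparts := hac.integral_mul_deriv_eq_deriv_mul hu.1
  rw [hu.2.2.1, hu.2.2.2, hderiv] at hparts
  rw [hparts]
  ring

end H10

section Primitive

variable {g : ℝ → ℝ} {C x y : ℝ}

lemma hasDerivAt_primitiveG (hg : Continuous g) (x : ℝ) : HasDerivAt (primitiveG g) (g x) x :=
  (hg.integral_hasStrictDerivAt 0 x).hasDerivAt

lemma continuous_primitiveG (hg : Continuous g) : Continuous (primitiveG g) :=
  continuous_iff_continuousAt.2 fun x => (hasDerivAt_primitiveG hg x).continuousAt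

lemma primitiveG_sub (hg : Continuous g) (x y : ℝ) :
    primitiveG g y - primitiveG g x = ∫ s in x..y, g s :=
  intervalIntegral.integral_interval_sub_left (hg.intervalIntegrable _ _)
    (hg.intervalIntegrable _ _)

lemma mul_sub_le_primitiveG_sub (hg : Continuous g) (hmono : MonotoneOn g (Ici 0))
    (hx : 0 ≤ x) (hy : 0 ≤ y) : g x * (y - x) ≤ primitiveG g y - primitiveG g x := by
  rw [primitiveG_sub hg]
  rcases le_total x y with h | h
  · have hle : ∫ _ in x..y, g x ≤ ∫ s in x..y, g s :=
      intervalIntegral.integral_mono_on h (by simp) (hg.intervalIntegrable _ _)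
        fun s hs => hmono hx (hx.trans hs.1) hs.1
    rw [intervalIntegral.integral_const, smul_eq_mul] at hle
    linarith
  · have hle : ∫ s in y..x, g s ≤ ∫ _ in y..x, g x :=
      intervalIntegral.integral_mono_on h (hg.intervalIntegrable _ _) (by simp)
        fun s hs => hmono (hy.trans hs.1) hx hs.2
    rw [intervalIntegral.integral_const, smul_eq_mul] at hle
    rw [intervalIntegral.integral_symm]
    linarith

lemma abs_primitiveG_sub_le (hg : Continuous g) (hC : ∀ s, 0 ≤ s → |g s| ≤ C)
    (hx : 0 ≤ x) (hy : 0 ≤ y) : |primitiveG g y - primitiveG g x| ≤ C * |y - x| := by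
  rw [primitiveG_sub hg, ← Real.norm_eq_abs]
  exact intervalIntegral.norm_integral_le_of_norm_le_const fun s hs =>
    hC s ((le_min hx hy).trans hs.1.le)

end Primitive

section Action

variable {g q u φ : ℝ → ℝ} {a b : ℝ}

lemma intervalIntegrable_action (hab : a ≤ b) (hg : Continuous g)
    (hq : IntervalIntegrable q volume a b) (hu : u ∈ H10 a b) :
    IntervalIntegrable (fun t => (1 / 2) * deriv u t ^ 2 - primitiveG g (u t) + q t * u t)
      volume a b :=
  (((H10.intervalIntegrable_deriv_sq hab hu).const_mul _).sub
    (intervalIntegrable_of_continuousOn_Icc hab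
      ((continuous_primitiveG hg).comp_continuousOn (H10.continuousOn hab hu)))).add
    (intervalIntegrable_mul_continuousOn hab hq (H10.continuousOn hab hu))

lemma intervalIntegrable_primitiveG_sub (hab : a ≤ b) (hg : Continuous g) (hu : u ∈ H10 a b)
    (hφ : φ ∈ H10 a b) :
    IntervalIntegrable (fun t => primitiveG g (u t + φ t) - primitiveG g (u t)) volume a b :=
  intervalIntegrable_of_continuousOn_Icc hab
    (((continuous_primitiveG hg).comp_continuousOn
      (H10.continuousOn hab (H10.add_mem hab hu hφ))).sub
      ((continuous_primitiveG hg).comp_continuousOn (H10.continuousOn hab hu)))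

lemma action_add_sub (hab : a ≤ b) (hg : Continuous g)
    (hq : IntervalIntegrable q volume a b) (hu : u ∈ H10 a b) (hφ : φ ∈ H10 a b) :
    action g q a b (fun t => u t + φ t) - action g q a b u =
      (∫ t in a..b, deriv u t * deriv φ t) + (1 / 2) * (∫ t in a..b, deriv φ t ^ 2)
        - (∫ t in a..b, (primitiveG g (u t + φ t) - primitiveG g (u t)))
        + ∫ t in a..b, q t * φ t := by
  have hderiv_mul := H10.intervalIntegrable_deriv_mul_deriv hab hu hφ
  have hderiv_sq := (H10.intervalIntegrable_deriv_sq hab hφ).const_mul (1 / 2)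
  have hG := intervalIntegrable_primitiveG_sub hab hg hu hφ
  have hqφ := intervalIntegrable_mul_continuousOn hab hq (H10.continuousOn hab hφ)
  rw [action, action, ← intervalIntegral.integral_sub
      (intervalIntegrable_action hab hg hq (H10.add_mem hab hu hφ))
      (intervalIntegrable_action hab hg hq hu), ← intervalIntegral.integral_const_mul,
    ← intervalIntegral.integral_add hderiv_mul hderiv_sq,
    ← intervalIntegral.integral_sub (hderiv_mul.add hderiv_sq) hG,
    ← intervalIntegral.integral_add ((hderiv_mul.add hderiv_sq).sub hG) hqφ]
  refine integral_congr_ae_Icc hab ?_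
  filter_upwards [ae_deriv_add hab hu.1 hφ.1] with t ht hmem
  rw [ht hmem]
  ring

end Action

/-- The derivative of the action at `u` in the direction `φ`. The Euler equation
`u'' + g(u) = q` says, in weak form, that it vanishes for all directions. -/
def firstVariation (g q : ℝ → ℝ) (a b : ℝ) (u φ : ℝ → ℝ) : ℝ :=
  (∫ t in a..b, deriv u t * deriv φ t) + ∫ t in a..b, (q t - g (u t)) * φ t

section FirstVariation

variable {g q u φ : ℝ → ℝ} {a b δ : ℝ}

lemma firstVariation_const_mul (c : ℝ) :
    firstVariation g q a b u (fun t => c * φ t) = c * firstVariation g q a b u φ := by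
  simp only [firstVariation, deriv_const_mul_field, mul_left_comm _ c,
    intervalIntegral.integral_const_mul, mul_add]

lemma firstVariation_neg :
    firstVariation g q a b u (fun t => -φ t) = -firstVariation g q a b u φ := by
  simpa only [neg_one_mul] using firstVariation_const_mul (-1)

lemma action_add_sub_le (hab : a ≤ b) (hg : Continuous g) (hmono : MonotoneOn g (Ici 0))
    (hq : IntervalIntegrable q volume a b) (hu : u ∈ H10plus a b) (hφ : φ ∈ H10 a b)
    (hnonneg : ∀ t ∈ Icc a b, 0 ≤ u t + φ t) :
    action g q a b (fun t => u t + φ t) - action g q a b u ≤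
      firstVariation g q a b u φ + (1 / 2) * ∫ t in a..b, deriv φ t ^ 2 := by
  have hu_cont := H10.continuousOn hab hu.1
  have hφ_cont := H10.continuousOn hab hφ
  have hgφ : IntervalIntegrable (fun t => g (u t) * φ t) volume a b :=
    intervalIntegrable_of_continuousOn_Icc hab ((hg.comp_continuousOn hu_cont).mul hφ_cont)
  have hconvex : ∫ t in a..b, g (u t) * φ t ≤
      ∫ t in a..b, (primitiveG g (u t + φ t) - primitiveG g (u t)) :=
    intervalIntegral.integral_mono_on hab hgφ
      (intervalIntegrable_primitiveG_sub hab hg hu.1 hφ) fun t ht => by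
        simpa only [add_sub_cancel_left] using
          mul_sub_le_primitiveG_sub hg hmono (hu.2 t ht) (hnonneg t ht)
  have hsplit : ∫ t in a..b, (q t - g (u t)) * φ t =
      (∫ t in a..b, q t * φ t) - ∫ t in a..b, g (u t) * φ t := by
    simp only [sub_mul]
    exact intervalIntegral.integral_sub (intervalIntegrable_mul_continuousOn hab hq hφ_cont) hgφ
  rw [action_add_sub hab hg hq hu.1 hφ, firstVariation, hsplit]
  linarith

lemma nonneg_of_forall_mul_add_sq_mul_nonneg {B N : ℝ} (hδ : 0 < δ)
    (h : ∀ s ∈ Ioc 0 δ, 0 ≤ s * B + s ^ 2 * N) : 0 ≤ B := by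
  have hlim : Tendsto (fun s => B + s * N) (𝓝[>] 0) (𝓝 B) :=
    (Continuous.tendsto' (by fun_prop) 0 B (by simp)).mono_left nhdsWithin_le_nhds
  refine ge_of_tendsto hlim ?_
  filter_upwards [Ioc_mem_nhdsGT hδ] with s hs
  refine nonneg_of_mul_nonneg_right (a := s) ?_ hs.1
  linarith [h s hs]

lemma IsMinimizer.firstVariation_nonneg (hab : a ≤ b) (hg : Continuous g)
    (hmono : MonotoneOn g (Ici 0)) (hq : IntervalIntegrable q volume a b)
    (hu : IsMinimizer g q a b u) (hφ : φ ∈ H10 a b) (hδ : 0 < δ)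
    (hnonneg : ∀ t ∈ Icc a b, 0 ≤ u t + δ * φ t) : 0 ≤ firstVariation g q a b u φ := by
  refine nonneg_of_forall_mul_add_sq_mul_nonneg (N := (1 / 2) * ∫ t in a..b, deriv φ t ^ 2) hδ
    fun s hs => ?_
  have hadm : ∀ t ∈ Icc a b, 0 ≤ u t + s * φ t := fun t ht => by
    refine nonneg_of_mul_nonneg_right (a := δ) ?_ hδ
    linarith [mul_nonneg (sub_nonneg.2 hs.2) (hu.1.2 t ht), mul_nonneg hs.1.le (hnonneg t ht)]
  have hsφ := H10.const_mul_mem hφ s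
  have hmin : action g q a b u ≤ action g q a b (fun t => u t + s * φ t) :=
    hu.2 (show _ ∈ H10plus a b from ⟨H10.add_mem hab hu.1.1 hsφ, hadm⟩)
  have hle := action_add_sub_le hab hg hmono hq hu.1 hsφ hadm
  simp only [firstVariation_const_mul, deriv_const_mul_field, mul_pow,
    intervalIntegral.integral_const_mul] at hle
  linarith

lemma IsMinimizer.firstVariation_eq_zero (hab : a ≤ b) (hg : Continuous g)
    (hmono : MonotoneOn g (Ici 0)) (hq : IntervalIntegrable q volume a b)
    (hu : IsMinimizer g q a b u) (hφ : φ ∈ H10 a b) (hpos : ∀ t ∈ Icc a b, 0 ≤ φ t)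
    (hδ : 0 < δ) (hle : ∀ t ∈ Icc a b, δ * φ t ≤ u t) : firstVariation g q a b u φ = 0 := by
  refine le_antisymm ?_ (hu.firstVariation_nonneg hab hg hmono hq hφ one_pos fun t ht => ?_)
  · rw [← neg_nonneg, ← firstVariation_neg]
    exact hu.firstVariation_nonneg hab hg hmono hq (H10.neg_mem hφ) hδ fun t ht => by
      linarith [hle t ht]
  · linarith [hu.1.2 t ht, hpos t ht]

end FirstVariation

/-- The piecewise linear function with value `1` at `y` that vanishes outside `(x, z)`, for
`x < y < z`. -/
def tent (x y z t : ℝ) : ℝ := max 0 (min ((t - x) / (y - x)) ((z - t) / (z - y)))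

section Tent

variable {f h : ℝ → ℝ} {a b x y z t : ℝ}

lemma tent_nonneg (x y z t : ℝ) : 0 ≤ tent x y z t := le_max_left _ _

lemma tent_le_one (hxy : x < y) (hyz : y < z) : tent x y z t ≤ 1 := by
  refine max_le zero_le_one ?_
  rcases le_total t y with h | h
  · exact (min_le_left _ _).trans ((div_le_one (by linarith)).2 (by linarith))
  · exact (min_le_right _ _).trans ((div_le_one (by linarith)).2 (by linarith))

lemma tent_of_le (hxy : x < y) (ht : t ≤ x) : tent x y z t = 0 :=
  max_eq_left ((min_le_left _ _).trans (div_nonpos_of_nonpos_of_nonneg (by linarith) (by linarith)))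

lemma tent_of_ge (hyz : y < z) (ht : z ≤ t) : tent x y z t = 0 :=
  max_eq_left ((min_le_right _ _).trans
    (div_nonpos_of_nonpos_of_nonneg (by linarith) (by linarith)))

lemma tent_of_mem_left (hxy : x < y) (hyz : y < z) (ht : t ∈ Icc x y) :
    tent x y z t = (t - x) / (y - x) := by
  have hle : (t - x) / (y - x) ≤ 1 := (div_le_one (by linarith)).2 (by linarith [ht.2])
  have hge : 1 ≤ (z - t) / (z - y) := (one_le_div (by linarith)).2 (by linarith [ht.2])
  rw [tent, min_eq_left (hle.trans hge)]
  exact max_eq_right (div_nonneg (by linarith [ht.1]) (by linarith))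

lemma tent_of_mem_right (hxy : x < y) (hyz : y < z) (ht : t ∈ Icc y z) :
    tent x y z t = (z - t) / (z - y) := by
  have hge : 1 ≤ (t - x) / (y - x) := (one_le_div (by linarith)).2 (by linarith [ht.1])
  have hle : (z - t) / (z - y) ≤ 1 := (div_le_one (by linarith)).2 (by linarith [ht.1])
  rw [tent, min_eq_right (hle.trans hge)]
  exact max_eq_right (div_nonneg (by linarith [ht.2]) (by linarith))

lemma exists_lipschitzWith_tent (x y z : ℝ) : ∃ K, LipschitzWith K (tent x y z) := by
  have hleft := (lipschitzWith_smul (y - x)⁻¹).comp (LipschitzWith.id.sub (LipschitzWith.const x))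
  have hright := (lipschitzWith_smul (z - y)⁻¹).comp ((LipschitzWith.const z).sub LipschitzWith.id)
  have htent : tent x y z = fun t => max 0 (min ((y - x)⁻¹ • (t - x)) ((z - y)⁻¹ • (z - t))) :=
    funext fun t => by simp only [tent, div_eq_inv_mul, smul_eq_mul]
  rw [htent]
  exact ⟨_, (hleft.min hright).const_max 0⟩

lemma tent_mem_H10 (hax : a ≤ x) (hxy : x < y) (hyz : y < z) (hzb : z ≤ b) :
    tent x y z ∈ H10 a b :=
  H10.mem_of_lipschitzWith (exists_lipschitzWith_tent x y z).choose_spec (tent_of_le hxy hax)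
    (tent_of_ge hyz hzb)

lemma deriv_tent_of_mem_left (hxy : x < y) (hyz : y < z) (ht : t ∈ Ioo x y) :
    deriv (tent x y z) t = 1 / (y - x) := by
  have hev : tent x y z =ᶠ[𝓝 t] fun s => (s - x) / (y - x) := by
    filter_upwards [Ioo_mem_nhds ht.1 ht.2] with s hs
    exact tent_of_mem_left hxy hyz (Ioo_subset_Icc_self hs)
  rw [hev.deriv_eq]
  exact (((hasDerivAt_id t).sub_const x).div_const (y - x)).deriv

lemma deriv_tent_of_mem_right (hxy : x < y) (hyz : y < z) (ht : t ∈ Ioo y z) :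
    deriv (tent x y z) t = -(1 / (z - y)) := by
  have hev : tent x y z =ᶠ[𝓝 t] fun s => (z - s) / (z - y) := by
    filter_upwards [Ioo_mem_nhds ht.1 ht.2] with s hs
    exact tent_of_mem_right hxy hyz (Ioo_subset_Icc_self hs)
  rw [hev.deriv_eq, ← neg_div]
  exact (((hasDerivAt_id t).const_sub z).div_const (z - y)).deriv

lemma deriv_tent_of_lt (hxy : x < y) (ht : t < x) : deriv (tent x y z) t = 0 := by
  have hev : tent x y z =ᶠ[𝓝 t] fun _ => 0 := by
    filter_upwards [Iio_mem_nhds ht] with s hs using tent_of_le hxy (le_of_lt hs)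
  rw [hev.deriv_eq, deriv_const]

lemma deriv_tent_of_gt (hyz : y < z) (ht : z < t) : deriv (tent x y z) t = 0 := by
  have hev : tent x y z =ᶠ[𝓝 t] fun _ => 0 := by
    filter_upwards [Ioi_mem_nhds ht] with s hs using tent_of_ge hyz (le_of_lt hs)
  rw [hev.deriv_eq, deriv_const]

lemma integral_mul_of_eqOn_const {c d k : ℝ} (hcd : c ≤ d) (hf : IntervalIntegrable f volume c d)
    (hk : ∀ t ∈ Ioo c d, h t = k) :
    IntervalIntegrable (fun t => f t * h t) volume c d ∧
      ∫ t in c..d, f t * h t = (∫ t in c..d, f t) * k := by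
  have hfk : EqOn (fun t => f t * k) (fun t => f t * h t) (Ioo c d) := fun t ht => by
    simp only [hk t ht]
  refine ⟨(hf.mul_const k).congr_uIoo (by rwa [uIoo_of_le hcd]), ?_⟩
  rw [← intervalIntegral.integral_mul_const]
  exact (intervalIntegral.integral_congr_Ioo_of_le hcd hfk).symm

lemma intervalIntegrable_mono {c d : ℝ} (hac : a ≤ c) (hcd : c ≤ d) (hdb : d ≤ b)
    (hf : IntervalIntegrable f volume a b) : IntervalIntegrable f volume c d :=
  hf.mono_set (by
    rw [uIcc_of_le hcd, uIcc_of_le (hac.trans (hcd.trans hdb))]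
    exact Icc_subset_Icc hac hdb)

lemma integral_mul_deriv_tent (hax : a ≤ x) (hxy : x < y) (hyz : y < z) (hzb : z ≤ b)
    (hf : IntervalIntegrable f volume a b) :
    ∫ t in a..b, f t * deriv (tent x y z) t =
      (∫ t in x..y, f t) / (y - x) - (∫ t in y..z, f t) / (z - y) := by
  obtain ⟨i₁, e₁⟩ := integral_mul_of_eqOn_const (h := deriv (tent x y z)) hax
    (intervalIntegrable_mono le_rfl hax (by linarith) hf) fun t ht => deriv_tent_of_lt hxy ht.2
  obtain ⟨i₂, e₂⟩ := integral_mul_of_eqOn_const hxy.le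
    (intervalIntegrable_mono hax hxy.le (by linarith) hf)
    fun t ht => deriv_tent_of_mem_left hxy hyz ht
  obtain ⟨i₃, e₃⟩ := integral_mul_of_eqOn_const hyz.le
    (intervalIntegrable_mono (by linarith) hyz.le hzb hf)
    fun t ht => deriv_tent_of_mem_right hxy hyz ht
  obtain ⟨i₄, e₄⟩ := integral_mul_of_eqOn_const (h := deriv (tent x y z)) hzb
    (intervalIntegrable_mono (by linarith) hzb le_rfl hf) fun t ht => deriv_tent_of_gt hyz ht.1
  rw [← intervalIntegral.integral_add_adjacent_intervals ((i₁.trans i₂).trans i₃) i₄,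
    ← intervalIntegral.integral_add_adjacent_intervals (i₁.trans i₂) i₃,
    ← intervalIntegral.integral_add_adjacent_intervals i₁ i₂, e₁, e₂, e₃, e₄]
  ring

lemma integral_deriv_mul_deriv_tent (hax : a ≤ x) (hxy : x < y) (hyz : y < z) (hzb : z ≤ b)
    (hf : AbsolutelyContinuousOnInterval f a b) :
    ∫ t in a..b, deriv f t * deriv (tent x y z) t =
      (f y - f x) / (y - x) - (f z - f y) / (z - y) := by
  have hmono : ∀ c d, a ≤ c → c ≤ d → d ≤ b → AbsolutelyContinuousOnInterval f c d :=
    fun c d hac hcd hdb => hf.mono (by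
      rw [uIcc_of_le hcd, uIcc_of_le (hac.trans (hcd.trans hdb))]
      exact Icc_subset_Icc hac hdb)
  rw [integral_mul_deriv_tent hax hxy hyz hzb hf.intervalIntegrable_deriv,
    (hmono x y hax hxy.le (by linarith)).integral_deriv_eq_sub,
    (hmono y z (by linarith) hyz.le hzb).integral_deriv_eq_sub]

lemma integral_deriv_tent_sq (hax : a ≤ x) (hxy : x < y) (hyz : y < z) (hzb : z ≤ b) :
    ∫ t in a..b, deriv (tent x y z) t ^ 2 = 1 / (y - x) + 1 / (z - y) := by
  have hderiv := integral_deriv_mul_deriv_tent hax hxy hyz hzb (tent_mem_H10 hax hxy hyz hzb).1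
  rw [tent_of_le hxy le_rfl, tent_of_ge hyz le_rfl,
    tent_of_mem_left hxy hyz (right_mem_Icc.2 hxy.le), div_self (by linarith)] at hderiv
  simp only [sq, hderiv]
  ring

lemma continuousOn_integral_Icc (hab : a ≤ b) (hh : IntervalIntegrable h volume a b) :
    ContinuousOn (fun t => ∫ s in a..t, h s) (Icc a b) := by
  simpa only [uIcc_of_le hab] using
    (hh.absolutelyContinuousOnInterval_intervalIntegral (c := a) left_mem_uIcc).continuousOn

lemma integral_mul_tent (hax : a ≤ x) (hxy : x < y) (hyz : y < z) (hzb : z ≤ b)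
    (hh : IntervalIntegrable h volume a b) :
    ∫ t in a..b, h t * tent x y z t =
      (∫ t in y..z, ∫ s in a..t, h s) / (z - y) - (∫ t in x..y, ∫ s in a..t, h s) / (y - x) := by
  have hab : a ≤ b := by linarith
  rw [H10.integral_mul_eq_neg_integral_mul_deriv hab (tent_mem_H10 hax hxy hyz hzb) hh 0]
  simp only [zero_add]
  rw [integral_mul_deriv_tent hax hxy hyz hzb
    (intervalIntegrable_of_continuousOn_Icc hab (continuousOn_integral_Icc hab hh)), neg_sub]

lemma integral_affine (x y c m : ℝ) :
    ∫ t in x..y, (c + m * t) = (y - x) * (c + m * ((x + y) / 2)) := by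
  rw [intervalIntegral.integral_add (by simp)
      ((continuous_const_mul m).intervalIntegrable _ _),
    intervalIntegral.integral_const, intervalIntegral.integral_const_mul, integral_id, smul_eq_mul]
  ring

lemma integral_tent (hax : a ≤ x) (hxy : x < y) (hyz : y < z) (hzb : z ≤ b) :
    ∫ t in a..b, tent x y z t = (z - x) / 2 := by
  have htent := integral_mul_tent (h := fun _ => 1) hax hxy hyz hzb (by simp)
  have hyx : y - x ≠ 0 := by linarith
  have hzy : z - y ≠ 0 := by linarith
  have haffine : ∀ c d, ∫ t in c..d, (t - a) = (d - c) * (-a + 1 * ((c + d) / 2)) := fun c d => by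
    rw [← integral_affine]
    simp only [one_mul, neg_add_eq_sub]
  simp only [one_mul, intervalIntegral.integral_const, smul_eq_mul, mul_one, haffine] at htent
  rw [htent]
  field_simp
  ring

lemma integral_mul_tent_le {B k : ℝ} (hax : a ≤ x) (hxy : x < y) (hyz : y < z) (hzb : z ≤ b)
    (hh : IntervalIntegrable h volume a b)
    (hmean : ∀ r s, a ≤ r → r ≤ s → s ≤ b → ∫ t in r..s, h t ≤ B * (s - r) + k) :
    ∫ t in a..b, h t * tent x y z t ≤ B * ((z - x) / 2) + k := by
  have hab : a ≤ b := by linarith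
  set P : ℝ → ℝ := fun t => ∫ s in a..t, h s
  have hP_int : IntervalIntegrable P volume a b :=
    intervalIntegrable_of_continuousOn_Icc hab (continuousOn_integral_Icc hab hh)
  have hP_le : ∀ r ∈ Icc x y, ∀ s ∈ Icc y z, P s ≤ P r + B * (s - r) + k := by
    intro r hr s hs
    have hsub : P s - P r = ∫ t in r..s, h t :=
      intervalIntegral.integral_interval_sub_left
        (intervalIntegrable_mono le_rfl (by linarith [hs.1]) (by linarith [hs.2]) hh)
        (intervalIntegrable_mono le_rfl (by linarith [hr.1]) (by linarith [hr.2]) hh)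
    linarith [hmean r s (hax.trans hr.1) (hr.2.trans hs.1) (hs.2.trans hzb)]
  have hright : ∀ r ∈ Icc x y, (∫ t in y..z, P t) / (z - y) ≤ P r - B * r + k + B * ((y + z) / 2) :=
    fun r hr => by
      rw [div_le_iff₀' (sub_pos.2 hyz), ← integral_affine]
      refine intervalIntegral.integral_mono_on hyz.le
        (intervalIntegrable_mono (by linarith) hyz.le hzb hP_int)
        (Continuous.intervalIntegrable (by fun_prop) _ _) fun s hs => ?_
      linarith [hP_le r hr s hs]
  have hleft : (∫ t in y..z, P t) / (z - y) - k - B * ((y + z) / 2) + B * ((x + y) / 2) ≤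
      (∫ t in x..y, P t) / (y - x) := by
    rw [le_div_iff₀' (sub_pos.2 hxy), ← integral_affine]
    refine intervalIntegral.integral_mono_on hxy.le
      (Continuous.intervalIntegrable (by fun_prop) _ _)
      (intervalIntegrable_mono hax hxy.le (by linarith) hP_int) fun r hr => ?_
    linarith [hright r hr]
  rw [integral_mul_tent hax hxy hyz hzb hh]
  linarith

end Tent

/-- The primitive of the force `q - g ∘ u` that vanishes at `a`. -/
def forcePrimitive (g q u : ℝ → ℝ) (a t : ℝ) : ℝ := ∫ s in a..t, (q s - g (u s))

/-- The difference between `u` and the second primitive of the force `q - g ∘ u`; the Euler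
equation `u'' + g(u) = q` says that it is affine. -/
def residual (g q u : ℝ → ℝ) (a t : ℝ) : ℝ := u t - ∫ s in a..t, forcePrimitive g q u a s

section Regularity

variable {g q u φ : ℝ → ℝ} {a b x y z : ℝ}

lemma intervalIntegrable_force (hab : a ≤ b) (hg : Continuous g)
    (hq : IntervalIntegrable q volume a b) (hu : ContinuousOn u (Icc a b)) :
    IntervalIntegrable (fun t => q t - g (u t)) volume a b :=
  hq.sub (intervalIntegrable_of_continuousOn_Icc hab (hg.comp_continuousOn hu))

lemma continuousOn_forcePrimitive (hab : a ≤ b) (hg : Continuous g)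
    (hq : IntervalIntegrable q volume a b) (hu : ContinuousOn u (Icc a b)) :
    ContinuousOn (forcePrimitive g q u a) (Icc a b) :=
  continuousOn_integral_Icc hab (intervalIntegrable_force hab hg hq hu)

lemma integral_interval_sub_Icc {f : ℝ → ℝ} (hf : IntervalIntegrable f volume a b)
    (hx : x ∈ Icc a b) (hy : y ∈ Icc a b) :
    (∫ t in a..y, f t) - ∫ t in a..x, f t = ∫ t in x..y, f t :=
  intervalIntegral.integral_interval_sub_left (intervalIntegrable_mono le_rfl hy.1 hy.2 hf)
    (intervalIntegrable_mono le_rfl hx.1 hx.2 hf)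

lemma firstVariation_tent (hax : a ≤ x) (hxy : x < y) (hyz : y < z) (hzb : z ≤ b)
    (hg : Continuous g) (hq : IntervalIntegrable q volume a b) (hu : u ∈ H10 a b) :
    firstVariation g q a b u (tent x y z) =
      (residual g q u a y - residual g q u a x) / (y - x) -
        (residual g q u a z - residual g q u a y) / (z - y) := by
  have hab : a ≤ b := by linarith
  have hu_cont := H10.continuousOn hab hu
  have hQ : IntervalIntegrable (forcePrimitive g q u a) volume a b :=
    intervalIntegrable_of_continuousOn_Icc hab (continuousOn_forcePrimitive hab hg hq hu_cont)
  have hx : x ∈ Icc a b := ⟨hax, by linarith⟩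
  have hy : y ∈ Icc a b := ⟨by linarith, by linarith⟩
  have hz : z ∈ Icc a b := ⟨by linarith, hzb⟩
  have htent := integral_mul_tent hax hxy hyz hzb (intervalIntegrable_force hab hg hq hu_cont)
  rw [firstVariation, integral_deriv_mul_deriv_tent hax hxy hyz hzb hu.1, htent]
  change _ + ((∫ t in y..z, forcePrimitive g q u a t) / _ -
    (∫ t in x..y, forcePrimitive g q u a t) / _) = _
  rw [← integral_interval_sub_Icc hQ hx hy, ← integral_interval_sub_Icc hQ hy hz]
  simp only [residual]
  ring

lemma IsMinimizer.concaveOn_residual (hab : a ≤ b) (hg : Continuous g)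
    (hmono : MonotoneOn g (Ici 0)) (hq : IntervalIntegrable q volume a b)
    (hu : IsMinimizer g q a b u) : ConcaveOn ℝ (Icc a b) (residual g q u a) := by
  refine concaveOn_of_slope_anti_adjacent (convex_Icc a b) fun {x y z} hx hz hxy hyz => ?_
  rw [← sub_nonneg, ← firstVariation_tent hx.1 hxy hyz hz.2 hg hq hu.1.1]
  exact hu.firstVariation_nonneg hab hg hmono hq (tent_mem_H10 hx.1 hxy hyz hz.2) one_pos
    fun t ht => add_nonneg (hu.1.2 t ht) (mul_nonneg zero_le_one (tent_nonneg x y z t))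

lemma IsMinimizer.firstVariation_tent_eq_zero (hax : a < x) (hxy : x < y) (hyz : y < z)
    (hzb : z < b) (hg : Continuous g) (hmono : MonotoneOn g (Ici 0))
    (hq : IntervalIntegrable q volume a b) (hu : IsMinimizer g q a b u)
    (hpos : ∀ t ∈ Ioo a b, 0 < u t) : firstVariation g q a b u (tent x y z) = 0 := by
  have hab : a ≤ b := by linarith
  obtain ⟨t₀, ht₀, hmin⟩ := isCompact_Icc.exists_isMinOn (nonempty_Icc.2 (hxy.trans hyz).le)
    ((H10.continuousOn hab hu.1.1).mono (Icc_subset_Icc hax.le hzb.le))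
  have hδ : 0 < u t₀ := hpos t₀ ⟨hax.trans_le ht₀.1, ht₀.2.trans_lt hzb⟩
  refine hu.firstVariation_eq_zero hab hg hmono hq (tent_mem_H10 hax.le hxy hyz hzb.le)
    (fun t _ => tent_nonneg x y z t) hδ fun t ht => ?_
  rcases le_total t x with htx | hxt
  · simpa only [tent_of_le hxy htx, mul_zero] using hu.1.2 t ht
  rcases le_total z t with hzt | htz
  · simpa only [tent_of_ge hyz hzt, mul_zero] using hu.1.2 t ht
  · exact (mul_le_of_le_one_right hδ.le (tent_le_one hxy hyz)).trans (hmin ⟨hxt, htz⟩)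

lemma IsMinimizer.convexOn_residual (hg : Continuous g) (hmono : MonotoneOn g (Ici 0))
    (hq : IntervalIntegrable q volume a b) (hu : IsMinimizer g q a b u)
    (hpos : ∀ t ∈ Ioo a b, 0 < u t) : ConvexOn ℝ (Ioo a b) (residual g q u a) := by
  refine convexOn_of_slope_mono_adjacent (convex_Ioo a b) fun {x y z} hx hz hxy hyz => ?_
  rw [← sub_nonpos, ← firstVariation_tent hx.1.le hxy hyz hz.2.le hg hq hu.1.1]
  exact (hu.firstVariation_tent_eq_zero hx.1 hxy hyz hz.2 hg hmono hq hpos).le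

lemma eq_add_slope_mul_of_convexOn_of_concaveOn {s : Set ℝ} {f : ℝ → ℝ} (hconv : ConvexOn ℝ s f)
    (hconc : ConcaveOn ℝ s f) (hx : x ∈ s) (hy : y ∈ s) (hxy : y ≠ x) (hz : z ∈ s) :
    f z = f x + slope f x y * (z - x) := by
  rcases eq_or_ne z x with rfl | hzx
  · simp
  have hslope : slope f x z = slope f x y := by
    rcases le_total y z with h | h
    · exact le_antisymm (hconc.slope_anti hx ⟨hy, hxy⟩ ⟨hz, hzx⟩ h)
        (hconv.slope_mono hx ⟨hy, hxy⟩ ⟨hz, hzx⟩ h)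
    · exact le_antisymm (hconv.slope_mono hx ⟨hz, hzx⟩ ⟨hy, hxy⟩ h)
        (hconc.slope_anti hx ⟨hz, hzx⟩ ⟨hy, hxy⟩ h)
  rw [← hslope, slope_def_field, div_mul_cancel₀ _ (sub_ne_zero.2 hzx), add_sub_cancel]

lemma exists_eqOn_affine_of_convexOn_of_concaveOn {f : ℝ → ℝ} (hab : a < b)
    (hf : ContinuousOn f (Icc a b)) (hconv : ConvexOn ℝ (Ioo a b) f)
    (hconc : ConcaveOn ℝ (Ioo a b) f) : ∃ c m, EqOn f (fun t => c + m * t) (Icc a b) := by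
  obtain ⟨x, hx⟩ := exists_between hab
  obtain ⟨y, hy⟩ := exists_between hx.2
  refine ⟨f x - slope f x y * x, slope f x y, ?_⟩
  refine EqOn.of_subset_closure (s := Ioo a b) (fun t ht => ?_) hf (by fun_prop)
    Ioo_subset_Icc_self (closure_Ioo hab.ne).ge
  have ht_eq := eq_add_slope_mul_of_convexOn_of_concaveOn hconv hconc hx ⟨hx.1.trans hy.1, hy.2⟩
    hy.1.ne' ht
  simp only [ht_eq]
  ring

lemma hasDerivWithinAt_integral_Icc {f : ℝ → ℝ} (hab : a ≤ b) (hf : ContinuousOn f (Icc a b))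
    {t : ℝ} (ht : t ∈ Icc a b) :
    HasDerivWithinAt (fun s => ∫ r in a..s, f r) (f t) (Icc a b) t :=
  haveI : Fact (t ∈ Icc a b) := ⟨ht⟩
  intervalIntegral.integral_hasDerivWithinAt_right
    (intervalIntegrable_mono le_rfl ht.1 ht.2 (intervalIntegrable_of_continuousOn_Icc hab hf))
    (hf.stronglyMeasurableAtFilter_nhdsWithin measurableSet_Icc t) (hf t ht)

lemma IsMinimizer.exists_hasDerivWithinAt (hab : a < b) (hg : Continuous g)
    (hmono : MonotoneOn g (Ici 0)) (hq : IntervalIntegrable q volume a b)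
    (hu : IsMinimizer g q a b u) (hpos : ∀ t ∈ Ioo a b, 0 < u t) :
    ∃ m, ∀ t ∈ Icc a b, HasDerivWithinAt u (m + forcePrimitive g q u a t) (Icc a b) t := by
  have hu_cont := H10.continuousOn hab.le hu.1.1
  have hQ_cont := continuousOn_forcePrimitive hab.le hg hq hu_cont
  have hres_cont : ContinuousOn (residual g q u a) (Icc a b) :=
    hu_cont.sub (continuousOn_integral_Icc hab.le
      (intervalIntegrable_of_continuousOn_Icc hab.le hQ_cont))
  obtain ⟨c, m, haffine⟩ := exists_eqOn_affine_of_convexOn_of_concaveOn hab hres_cont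
    (hu.convexOn_residual hg hmono hq hpos)
    ((hu.concaveOn_residual hab.le hg hmono hq).subset Ioo_subset_Icc_self (convex_Ioo a b))
  have hu_eq : EqOn u (fun t => c + m * t + ∫ s in a..t, forcePrimitive g q u a s) (Icc a b) :=
    fun t ht => eq_add_of_sub_eq (haffine ht)
  refine ⟨m, fun t ht => ?_⟩
  have hderiv_affine : HasDerivWithinAt (fun s => c + m * s) m (Icc a b) t := by
    simpa using (((hasDerivAt_id t).const_mul m).const_add c).hasDerivWithinAt
  exact (hderiv_affine.add (hasDerivWithinAt_integral_Icc hab.le hQ_cont ht)).congr hu_eq (hu_eq ht)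

lemma IsMinimizer.solvesDirichlet (hab : a < b) (hg : Continuous g)
    (hmono : MonotoneOn g (Ici 0)) (hq : IntervalIntegrable q volume a b)
    (hu : IsMinimizer g q a b u) (hpos : ∀ t ∈ Ioo a b, 0 < u t) :
    SolvesDirichlet g q a b u := by
  obtain ⟨m, hm⟩ := hu.exists_hasDerivWithinAt hab hg hmono hq hpos
  have hforce := intervalIntegrable_force hab.le hg hq (H10.continuousOn hab.le hu.1.1)
  refine ⟨⟨fun t => m + forcePrimitive g q u a t, ?_, hm, ae_restrict_Ioo_of_ae_Icc ?_⟩,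
    hu.1.1.2.2.1, hu.1.1.2.2.2, hpos⟩
  · exact (LipschitzWith.const m).lipschitzOnWith.absolutelyContinuousOnInterval.add
      (hforce.absolutelyContinuousOnInterval_intervalIntegral left_mem_uIcc)
  · filter_upwards [hforce.ae_hasDerivAt_integral] with t ht hmem
    rw [uIcc_of_le hab.le] at ht
    exact (ht hmem a (left_mem_Icc.2 hab.le)).const_add m

lemma contDiffOn_two_of_hasDerivAt {f f' f'' : ℝ → ℝ} (hf : ∀ t ∈ Ioo a b, HasDerivAt f (f' t) t)
    (hf' : ∀ t ∈ Ioo a b, HasDerivAt f' (f'' t) t) (hf'' : ContinuousOn f'' (Ioo a b)) :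
    ContDiffOn ℝ 2 f (Ioo a b) := by
  have hf'_contDiff : ContDiffOn ℝ 1 f' (Ioo a b) := by
    rw [← zero_add (1 : WithTop ℕ∞), contDiffOn_succ_iff_deriv_of_isOpen isOpen_Ioo]
    refine ⟨fun t ht => (hf' t ht).differentiableAt.differentiableWithinAt, by simp, ?_⟩
    exact contDiffOn_zero.2 (hf''.congr fun t ht => (hf' t ht).deriv)
  rw [← one_add_one_eq_two, contDiffOn_succ_iff_deriv_of_isOpen isOpen_Ioo]
  exact ⟨fun t ht => (hf t ht).differentiableAt.differentiableWithinAt, by simp,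
    hf'_contDiff.congr fun t ht => (hf t ht).deriv⟩

lemma hasDerivAt_forcePrimitive (hg : Continuous g) (hq : IntervalIntegrable q volume a b)
    (hu : ContinuousOn u (Icc a b)) (hqc : ContinuousOn q (Ioo a b)) {t : ℝ} (ht : t ∈ Ioo a b) :
    HasDerivAt (forcePrimitive g q u a) (q t - g (u t)) t := by
  have hforce_cont : ContinuousOn (fun t => q t - g (u t)) (Ioo a b) :=
    hqc.sub (hg.comp_continuousOn (hu.mono Ioo_subset_Icc_self))
  exact intervalIntegral.integral_hasDerivAt_right
    (intervalIntegrable_mono le_rfl ht.1.le ht.2.le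
      (intervalIntegrable_force (ht.1.trans ht.2).le hg hq hu))
    (hforce_cont.stronglyMeasurableAtFilter isOpen_Ioo t ht)
    (hforce_cont.continuousAt (isOpen_Ioo.mem_nhds ht))

lemma IsMinimizer.solvesDirichletClassically (hab : a < b) (hg : Continuous g)
    (hmono : MonotoneOn g (Ici 0)) (hq : IntervalIntegrable q volume a b)
    (hu : IsMinimizer g q a b u) (hpos : ∀ t ∈ Ioo a b, 0 < u t)
    (hqc : ContinuousOn q (Ioo a b)) : SolvesDirichletClassically g q a b u := by
  obtain ⟨m, hm⟩ := hu.exists_hasDerivWithinAt hab hg hmono hq hpos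
  have hu_cont := H10.continuousOn hab.le hu.1.1
  have hderiv : ∀ t ∈ Ioo a b, HasDerivAt u (m + forcePrimitive g q u a t) t := fun t ht =>
    (hm t (Ioo_subset_Icc_self ht)).hasDerivAt (Icc_mem_nhds ht.1 ht.2)
  have hderiv₂ : ∀ t ∈ Ioo a b,
      HasDerivAt (fun t => m + forcePrimitive g q u a t) (q t - g (u t)) t := fun t ht =>
    (hasDerivAt_forcePrimitive hg hq hu_cont hqc ht).const_add m
  refine ⟨contDiffOn_two_of_hasDerivAt hderiv hderiv₂
    (hqc.sub (hg.comp_continuousOn (hu_cont.mono Ioo_subset_Icc_self))), hu_cont,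
    fun t ht => ?_, hu.1.1.2.2.1, hu.1.1.2.2.2, hpos⟩
  have hev : deriv u =ᶠ[𝓝 t] fun t => m + forcePrimitive g q u a t := by
    filter_upwards [isOpen_Ioo.mem_nhds ht] with s hs using (hderiv s hs).deriv
  rw [hev.deriv_eq, (hderiv₂ t ht).deriv, sub_add_cancel]

lemma IsMinimizer.firstVariation_eq_zero_of_pos (hab : a < b) (hg : Continuous g)
    (hmono : MonotoneOn g (Ici 0)) (hq : IntervalIntegrable q volume a b)
    (hu : IsMinimizer g q a b u) (hpos : ∀ t ∈ Ioo a b, 0 < u t) (hφ : φ ∈ H10 a b) :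
    firstVariation g q a b u φ = 0 := by
  obtain ⟨m, hm⟩ := hu.exists_hasDerivWithinAt hab hg hmono hq hpos
  have hforce := intervalIntegrable_force hab.le hg hq (H10.continuousOn hab.le hu.1.1)
  rw [firstVariation, H10.integral_mul_eq_neg_integral_mul_deriv hab.le hφ hforce m,
    ← sub_eq_add_neg, sub_eq_zero]
  refine intervalIntegral.integral_congr_Ioo_of_le hab.le fun t ht => ?_
  rw [((hm t (Ioo_subset_Icc_self ht)).hasDerivAt (Icc_mem_nhds ht.1 ht.2)).deriv, forcePrimitive]

end Regularity

section Uniqueness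

variable {g q u v : ℝ → ℝ} {a b x y : ℝ}

lemma trapezoid_lt_integral_of_strictConcaveOn (hxy : x < y) (hg : ContinuousOn g (Icc x y))
    (hconc : StrictConcaveOn ℝ (Icc x y) g) :
    (1 / 2) * (g x + g y) * (y - x) < ∫ s in x..y, g s := by
  set k := (g y - g x) / (y - x) with hk
  have hk_mul : k * (y - x) = g y - g x := div_mul_cancel₀ _ (sub_pos.2 hxy).ne'
  have hchord : ∀ t ∈ Ioo x y, g x - k * x + k * t < g t := fun t ht => by
    have hsecant := hconc.secant_strict_mono (left_mem_Icc.2 hxy.le) (Ioo_subset_Icc_self ht)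
      (right_mem_Icc.2 hxy.le) ht.1.ne' hxy.ne' ht.2
    rw [← hk, lt_div_iff₀ (sub_pos.2 ht.1)] at hsecant
    linarith
  have hint : ∫ t in x..y, (g x - k * x + k * t) = (1 / 2) * (g x + g y) * (y - x) := by
    rw [integral_affine]
    linear_combination (y - x) / 2 * hk_mul
  rw [← hint]
  obtain ⟨t₀, ht₀⟩ := exists_between hxy
  refine intervalIntegral.integral_lt_integral_of_continuousOn_of_le_of_exists_lt hxy
    (by fun_prop) hg (fun t ht => ?_) ⟨t₀, Ioo_subset_Icc_self ht₀, hchord t₀ ht₀⟩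
  rcases ht.2.eq_or_lt with rfl | hty
  · linarith
  · exact (hchord t ⟨ht.1, hty⟩).le

lemma action_max_add_action_min (hab : a ≤ b) (hg : Continuous g)
    (hq : IntervalIntegrable q volume a b) (hu : u ∈ H10 a b) (hv : v ∈ H10 a b) :
    action g q a b (fun t => max (u t) (v t)) + action g q a b (fun t => min (u t) (v t)) =
      action g q a b u + action g q a b v := by
  rw [action, action, action, action,
    ← intervalIntegral.integral_add (intervalIntegrable_action hab hg hq (H10.max_mem hab hu hv))
      (intervalIntegrable_action hab hg hq (H10.min_mem hab hu hv)),
    ← intervalIntegral.integral_add (intervalIntegrable_action hab hg hq hu)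
      (intervalIntegrable_action hab hg hq hv)]
  refine integral_congr_ae_Icc hab ?_
  filter_upwards [ae_deriv_max_min hab hu.1 hv.1] with t ht hmem
  rcases ht hmem with ⟨hle, hmax, hmin⟩ | ⟨hle, hmax, hmin⟩
  · rw [hmax, hmin, max_eq_left hle, min_eq_right hle]
  · rw [hmax, hmin, max_eq_right hle, min_eq_left hle, add_comm]

lemma IsMinimizer.max_isMinimizer (hab : a ≤ b) (hg : Continuous g)
    (hq : IntervalIntegrable q volume a b) (hu : IsMinimizer g q a b u)
    (hv : IsMinimizer g q a b v) : IsMinimizer g q a b (fun t => max (u t) (v t)) := by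
  have hmax : (fun t => max (u t) (v t)) ∈ H10plus a b :=
    ⟨H10.max_mem hab hu.1.1 hv.1.1, fun t ht => (hu.1.2 t ht).trans (le_max_left _ _)⟩
  have hmin : (fun t => min (u t) (v t)) ∈ H10plus a b :=
    ⟨H10.min_mem hab hu.1.1 hv.1.1, fun t ht => le_min (hu.1.2 t ht) (hv.1.2 t ht)⟩
  refine ⟨hmax, fun w hw => ?_⟩
  have hsum := action_max_add_action_min hab hg hq hu.1.1 hv.1.1
  have hv_le : action g q a b v ≤ action g q a b fun t => min (u t) (v t) := hv.2 hmin
  have hu_le : action g q a b u ≤ action g q a b w := hu.2 hw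
  change action g q a b _ ≤ action g q a b w
  linarith

/-- The error `G(y) - G(x) - (g(x) + g(y)) (y - x) / 2` of the trapezoidal rule for `∫ g` over
`[x, y]`, which measures by how much the action fails to be quadratic. -/
def trapezoidError (g : ℝ → ℝ) (x y : ℝ) : ℝ :=
  primitiveG g y - primitiveG g x - (1 / 2) * (g x + g y) * (y - x)

lemma trapezoidError_pos (hg : Continuous g) (hconc : StrictConcaveOn ℝ (Ioi 0) g) (hx : 0 < x)
    (hxy : x < y) : 0 < trapezoidError g x y := by
  rw [trapezoidError, primitiveG_sub hg, sub_pos]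
  exact trapezoid_lt_integral_of_strictConcaveOn hxy hg.continuousOn
    (hconc.subset (fun s hs => hx.trans_le hs.1) (convex_Icc x y))

lemma continuousOn_trapezoidError (hg : Continuous g) {s : Set ℝ} (hu : ContinuousOn u s)
    (hv : ContinuousOn v s) : ContinuousOn (fun t => trapezoidError g (u t) (v t)) s := by
  have hG := continuous_primitiveG hg
  simp only [trapezoidError]
  fun_prop

lemma action_sub_action (hab : a ≤ b) (hg : Continuous g)
    (hq : IntervalIntegrable q volume a b) (hu : u ∈ H10 a b) (hv : v ∈ H10 a b) :
    action g q a b v - action g q a b u =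
      (1 / 2) * (firstVariation g q a b u (fun t => v t - u t) +
        firstVariation g q a b v (fun t => v t - u t)) -
      ∫ t in a..b, trapezoidError g (u t) (v t) := by
  have hw := H10.sub_mem hab hv hu
  have hu_cont := H10.continuousOn hab hu
  have hv_cont := H10.continuousOn hab hv
  have hw_cont := H10.continuousOn hab hw
  have hvar : ∀ f ∈ H10 a b, IntervalIntegrable (fun t => deriv f t *
      deriv (fun s => v s - u s) t + (q t - g (f t)) * (v t - u t)) volume a b := fun f hf =>
    (H10.intervalIntegrable_deriv_mul_deriv hab hf hw).add (intervalIntegrable_mul_continuousOn hab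
      (intervalIntegrable_force hab hg hq (H10.continuousOn hab hf)) hw_cont)
  have hvar_eq : ∀ f ∈ H10 a b, firstVariation g q a b f (fun t => v t - u t) =
      ∫ t in a..b, (deriv f t * deriv (fun s => v s - u s) t +
        (q t - g (f t)) * (v t - u t)) := fun f hf =>
    (intervalIntegral.integral_add (H10.intervalIntegrable_deriv_mul_deriv hab hf hw)
      (intervalIntegrable_mul_continuousOn hab
        (intervalIntegrable_force hab hg hq (H10.continuousOn hab hf)) hw_cont)).symm
  have herr := intervalIntegrable_of_continuousOn_Icc hab
    (continuousOn_trapezoidError hg hu_cont hv_cont)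
  rw [action, action, ← intervalIntegral.integral_sub (intervalIntegrable_action hab hg hq hv)
      (intervalIntegrable_action hab hg hq hu), hvar_eq u hu, hvar_eq v hv,
    ← intervalIntegral.integral_add (hvar u hu) (hvar v hv),
    ← intervalIntegral.integral_const_mul,
    ← intervalIntegral.integral_sub (((hvar u hu).add (hvar v hv)).const_mul _) herr]
  refine integral_congr_ae_Icc hab ?_
  filter_upwards [ae_deriv_sub hab hv.1 hu.1] with t ht hmem
  rw [ht hmem, trapezoidError]
  ring

lemma IsMinimizer.integral_trapezoidError_eq_zero (hab : a < b) (hg : Continuous g)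
    (hmono : MonotoneOn g (Ici 0)) (hq : IntervalIntegrable q volume a b)
    (hu : IsMinimizer g q a b u) (hv : IsMinimizer g q a b v)
    (hu_pos : ∀ t ∈ Ioo a b, 0 < u t) (hv_pos : ∀ t ∈ Ioo a b, 0 < v t) :
    ∫ t in a..b, trapezoidError g (u t) (v t) = 0 := by
  have hw := H10.sub_mem hab.le hv.1.1 hu.1.1
  have hact := action_sub_action hab.le hg hq hu.1.1 hv.1.1
  rw [hu.firstVariation_eq_zero_of_pos hab hg hmono hq hu_pos hw,
    hv.firstVariation_eq_zero_of_pos hab hg hmono hq hv_pos hw] at hact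
  have huv : action g q a b u ≤ action g q a b v := hu.2 hv.1
  have hvu : action g q a b v ≤ action g q a b u := hv.2 hu.1
  linarith

lemma IsMinimizer.eqOn_of_le (hab : a < b) (hg : Continuous g) (hmono : MonotoneOn g (Ici 0))
    (hconc : StrictConcaveOn ℝ (Ioi 0) g) (hq : IntervalIntegrable q volume a b)
    (hu : IsMinimizer g q a b u) (hv : IsMinimizer g q a b v)
    (hpos : ∀ t ∈ Ioo a b, 0 < u t) (hle : ∀ t ∈ Icc a b, u t ≤ v t) : EqOn u v (Icc a b) := by
  have hzero := hu.integral_trapezoidError_eq_zero hab hg hmono hq hv hpos fun t ht =>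
    (hpos t ht).trans_le (hle t (Ioo_subset_Icc_self ht))
  have herr_pos : ∀ t ∈ Icc a b, u t < v t → 0 < trapezoidError g (u t) (v t) :=
      fun t ht hlt => by
    refine trapezoidError_pos hg hconc (hpos t ⟨ht.1.lt_of_ne ?_, ht.2.lt_of_ne ?_⟩) hlt
    · rintro rfl
      exact hlt.ne (hu.1.1.2.2.1.trans hv.1.1.2.2.1.symm)
    · rintro rfl
      exact hlt.ne (hu.1.1.2.2.2.trans hv.1.1.2.2.2.symm)
  intro t ht
  by_contra hne
  refine (intervalIntegral.integral_pos hab (continuousOn_trapezoidError hg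
    (H10.continuousOn hab.le hu.1.1) (H10.continuousOn hab.le hv.1.1)) (fun s hs => ?_)
    ⟨t, ht, herr_pos t ht ((hle t ht).lt_of_ne hne)⟩).ne' hzero
  have hs_mem := Ioc_subset_Icc_self hs
  rcases (hle s hs_mem).eq_or_lt with heq | hlt
  · simp [trapezoidError, heq]
  · exact (herr_pos s hs_mem hlt).le

lemma IsMinimizer.eqOn (hab : a < b) (hg : Continuous g) (hmono : MonotoneOn g (Ici 0))
    (hconc : StrictConcaveOn ℝ (Ioi 0) g) (hq : IntervalIntegrable q volume a b)
    (hu : IsMinimizer g q a b u) (hv : IsMinimizer g q a b v)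
    (hu_pos : ∀ t ∈ Ioo a b, 0 < u t) (hv_pos : ∀ t ∈ Ioo a b, 0 < v t) :
    EqOn u v (Icc a b) := by
  have hmax := hu.max_isMinimizer hab.le hg hq hv
  have hu_eq := hu.eqOn_of_le hab hg hmono hconc hq hmax hu_pos fun t _ => le_max_left _ _
  have hv_eq := hv.eqOn_of_le hab hg hmono hconc hq hmax hv_pos fun t _ => le_max_right _ _
  exact hu_eq.trans hv_eq.symm

end Uniqueness

lemma exists_last_le {u : ℝ → ℝ} {c t R : ℝ} (hct : c ≤ t) (hu : ContinuousOn u (Icc c t))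
    (hc : u c ≤ R) (ht : R < u t) : ∃ s ∈ Ico c t, u s = R ∧ ∀ r ∈ Icc s t, R ≤ u r := by
  have hcompact : IsCompact (Icc c t ∩ u ⁻¹' Iic R) :=
    isCompact_Icc.of_isClosed_subset (hu.preimage_isClosed_of_isClosed isClosed_Icc isClosed_Iic)
      inter_subset_left
  obtain ⟨s, ⟨hs_mem, hs_le⟩, hs_max⟩ := hcompact.exists_isGreatest ⟨c, left_mem_Icc.2 hct, hc⟩
  have hst : s < t := hs_mem.2.lt_of_ne fun h => ht.not_ge (h ▸ hs_le)
  have hR_le : ∀ r ∈ Ioc s t, R ≤ u r := fun r hr =>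
    le_of_not_gt fun hlt => hr.1.not_ge (hs_max ⟨⟨hs_mem.1.trans hr.1.le, hr.2⟩, hlt.le⟩)
  have hus : u s = R := by
    obtain ⟨r, hr, hur⟩ := intermediate_value_Icc hst.le
      (hu.mono (Icc_subset_Icc_left hs_mem.1)) ⟨hs_le, ht.le⟩
    rwa [le_antisymm (hs_max ⟨⟨hs_mem.1.trans hr.1, hr.2⟩, hur.le⟩) hr.1] at hur
  refine ⟨s, ⟨hs_mem.1, hst⟩, hus, fun r hr => ?_⟩
  rcases hr.1.eq_or_lt with rfl | hsr
  · exact hus.ge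
  · exact hR_le r ⟨hsr, hr.2⟩

/-- The setting of the a priori bound. The function `u ≥ 0` satisfies `u'' ≤ Q'` on `[a, b]`,
stated as concavity of `u` minus a primitive of `Q`; on intervals of length at most `2` the
function `Q` rises by at most `D`, and wherever `u ≥ R` it decays at rate `η` up to the error `k`.
The shape is invariant under `t ↦ -t`. -/
structure IsDampedAbove (u Q : ℝ → ℝ) (a b R D k η : ℝ) : Prop where
  continuousOn : ContinuousOn u (Icc a b)
  continuousOn_force : ContinuousOn Q (Icc a b)
  nonneg : ∀ t ∈ Icc a b, 0 ≤ u t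
  slope_anti : ∀ x y z, a ≤ x → x < y → y < z → z ≤ b →
    (u z - u y - ∫ t in y..z, Q t) / (z - y) ≤ (u y - u x - ∫ t in x..y, Q t) / (y - x)
  sub_le : ∀ r s, a ≤ r → r ≤ s → s ≤ b → s ≤ r + 2 → Q s - Q r ≤ D
  sub_le_of_le : ∀ r s, a ≤ r → r ≤ s → s ≤ b → (∀ t ∈ Icc r s, R ≤ u t) →
    Q s - Q r ≤ k - η * (s - r)

namespace IsDampedAbove

variable {u Q : ℝ → ℝ} {a b c s t R D k η : ℝ}

lemma reflect (h : IsDampedAbove u Q a b R D k η) :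
    IsDampedAbove (fun t => u (-t)) (fun t => -Q (-t)) (-b) (-a) R D k η := by
  have hneg : MapsTo (fun t : ℝ => -t) (Icc (-b) (-a)) (Icc a b) := fun t ht =>
    ⟨le_neg_of_le_neg ht.2, neg_le_of_neg_le ht.1⟩
  refine ⟨h.continuousOn.comp (by fun_prop) hneg,
    (h.continuousOn_force.comp (by fun_prop) hneg).neg, fun t ht => h.nonneg _ (hneg ht),
    fun x y z hbx hxy hyz hza => ?_, fun r s hbr hrs hsa hlen => ?_,
    fun r s hbr hrs hsa hlarge => ?_⟩
  · have hslope := h.slope_anti (-z) (-y) (-x) (by linarith) (by linarith) (by linarith)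
      (by linarith)
    simp only [intervalIntegral.integral_neg, intervalIntegral.integral_comp_neg]
    rw [neg_sub_neg, neg_sub_neg] at hslope
    rw [← neg_le_neg_iff, ← neg_div, ← neg_div]
    convert hslope using 2 <;> ring
  · have := h.sub_le (-s) (-r) (by linarith) (by linarith) (by linarith) (by linarith)
    linarith
  · have := h.sub_le_of_le (-s) (-r) (by linarith) (by linarith) (by linarith) fun t ht => by
      simpa only [neg_neg] using hlarge (-t) ⟨le_neg_of_le_neg ht.2, neg_le_of_neg_le ht.1⟩
    linarith

lemma intervalIntegrable_force (h : IsDampedAbove u Q a b R D k η) (has : a ≤ s) (hst : s ≤ t)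
    (htb : t ≤ b) : IntervalIntegrable Q volume s t :=
  intervalIntegrable_of_continuousOn_Icc hst
    (h.continuousOn_force.mono (Icc_subset_Icc has htb))

lemma exists_sub_le (h : IsDampedAbove u Q a b R D k η) (hR : 0 < R) (hac : a < c) (hc : u c = 0)
    (hcs : c ≤ s) (hsb : s ≤ b) (hs : u s = R) :
    ∃ x y, a ≤ x ∧ x < y ∧ y ≤ s ∧ s ≤ x + 2 ∧ u y - u x ≤ R * (y - x) := by
  rcases le_or_gt c (s - 1) with hfar | hnear
  · refine ⟨s - 1, s, by linarith, by linarith, le_rfl, by linarith, ?_⟩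
    linarith [h.nonneg (s - 1) ⟨by linarith, by linarith⟩]
  · have hxc : max a (c - 1) < c := max_lt hac (by linarith)
    refine ⟨max a (c - 1), c, le_max_left _ _, hxc, hcs, by linarith [le_max_right a (c - 1)], ?_⟩
    have hu_nonneg := h.nonneg (max a (c - 1)) ⟨le_max_left _ _, hxc.le.trans (hcs.trans hsb)⟩
    linarith [mul_nonneg hR.le (sub_nonneg.2 hxc.le)]

lemma sub_sub_integral_le (h : IsDampedAbove u Q a b R D k η) {x y : ℝ} (hax : a ≤ x)
    (hxy : x < y) (hys : y ≤ s) (hsx : s ≤ x + 2) (hst : s < t) (htb : t ≤ b)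
    (hle : u y - u x ≤ R * (y - x)) :
    u t - u s - ∫ r in s..t, Q r ≤ (R + D - Q s) * (t - s) := by
  have hlow := intervalIntegral.integral_mono_on (f := fun _ => Q s - D) hxy.le (by simp)
    (h.intervalIntegrable_force hax hxy.le (by linarith)) fun r hr => by
      linarith [h.sub_le r s (hax.trans hr.1) (hr.2.trans hys) (by linarith) (by linarith [hr.1])]
  rw [intervalIntegral.integral_const, smul_eq_mul] at hlow
  have hslope_xy : (u y - u x - ∫ r in x..y, Q r) / (y - x) ≤ R + D - Q s := by
    rw [div_le_iff₀ (sub_pos.2 hxy)]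
    linarith
  rw [← div_le_iff₀ (sub_pos.2 hst)]
  rcases hys.eq_or_lt with rfl | hys
  · exact (h.slope_anti x y t hax hxy hst htb).trans hslope_xy
  · exact (h.slope_anti y s t (hax.trans hxy.le) hys hst htb).trans
      ((h.slope_anti x y s hax hxy hys (hst.le.trans htb)).trans hslope_xy)

lemma integral_le (h : IsDampedAbove u Q a b R D k η) (has : a ≤ s) (hst : s ≤ t) (htb : t ≤ b)
    (hlarge : ∀ r ∈ Icc s t, R ≤ u r) :
    ∫ r in s..t, Q r ≤ (Q s + k) * (t - s) - η * (t - s) ^ 2 / 2 := by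
  have hup : ∫ r in s..t, Q r ≤ ∫ r in s..t, (Q s + k + η * s + -η * r) :=
    intervalIntegral.integral_mono_on hst (h.intervalIntegrable_force has hst htb)
      (Continuous.intervalIntegrable (by fun_prop) _ _) fun r hr => by
        linarith [h.sub_le_of_le s r has hr.1 (hr.2.trans htb) fun w hw =>
          hlarge w ⟨hw.1, hw.2.trans hr.2⟩]
  rw [integral_affine] at hup
  linarith

lemma le_of_zero_left (h : IsDampedAbove u Q a b R D k η) (hη : 0 < η) (hR : 0 < R)
    (hac : a < c) (hc : u c = 0) (ht : t ∈ Icc c b) :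
    u t ≤ R + (R + D + k) ^ 2 / (2 * η) := by
  rcases le_or_gt (u t) R with hle | hRt
  · exact hle.trans (le_add_of_nonneg_right (by positivity))
  obtain ⟨s, hs, hus, hlarge⟩ := exists_last_le ht.1
    (h.continuousOn.mono (Icc_subset_Icc hac.le ht.2)) (hc.le.trans hR.le) hRt
  obtain ⟨x, y, hax, hxy, hys, hsx, hle⟩ :=
    h.exists_sub_le hR hac hc hs.1 (hs.2.le.trans ht.2) hus
  have hslope := h.sub_sub_integral_le hax hxy hys hsx hs.2 ht.2 hle
  have hint := h.integral_le (hac.le.trans hs.1) hs.2.le ht.2 hlarge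
  have hquad : (R + D + k) * (t - s) - η * (t - s) ^ 2 / 2 ≤ (R + D + k) ^ 2 / (2 * η) := by
    rw [le_div_iff₀ (by positivity)]
    linarith [sq_nonneg (R + D + k - η * (t - s))]
  linarith

lemma le_of_zero_right (h : IsDampedAbove u Q a b R D k η) (hη : 0 < η) (hR : 0 < R)
    (hcb : c < b) (hc : u c = 0) (ht : t ∈ Icc a c) :
    u t ≤ R + (R + D + k) ^ 2 / (2 * η) := by
  have := h.reflect.le_of_zero_left (c := -c) (t := -t) hη hR (neg_lt_neg hcb)
    (by rwa [neg_neg]) ⟨neg_le_neg ht.2, neg_le_neg ht.1⟩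
  rwa [neg_neg] at this

end IsDampedAbove

section MinimizerBound

variable {g q u : ℝ → ℝ} {a b B R k η : ℝ}

lemma forcePrimitive_sub_le {r s γ : ℝ} (har : a ≤ r) (hrs : r ≤ s) (hsb : s ≤ b)
    (hg : Continuous g) (hq : IntervalIntegrable q volume a b) (hu : ContinuousOn u (Icc a b))
    (hmean : ∫ t in r..s, q t ≤ B * (s - r) + k) (hγ : ∀ t ∈ Icc r s, γ ≤ g (u t)) :
    forcePrimitive g q u a s - forcePrimitive g q u a r ≤ k - (γ - B) * (s - r) := by
  have hab : a ≤ b := har.trans (hrs.trans hsb)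
  have hforce := intervalIntegrable_force hab hg hq hu
  have hq_rs := intervalIntegrable_mono har hrs hsb hq
  have hle := intervalIntegral.integral_mono_on hrs
    (intervalIntegrable_mono har hrs hsb hforce) (hq_rs.sub (intervalIntegrable_const (c := γ)))
    fun t ht => sub_le_sub_left (hγ t ht) (q t)
  rw [intervalIntegral.integral_sub hq_rs intervalIntegrable_const,
    intervalIntegral.integral_const, smul_eq_mul] at hle
  have hsub := integral_interval_sub_Icc hforce ⟨har, hrs.trans hsb⟩ ⟨har.trans hrs, hsb⟩
  simp only [forcePrimitive] at hsub ⊢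
  linarith

lemma IsMinimizer.isDampedAbove (hab : a ≤ b) (hg : Continuous g) (hg0 : g 0 = 0)
    (hmono : MonotoneOn g (Ici 0)) (hq : IntervalIntegrable q volume a b)
    (hmean : ∀ r s, a ≤ r → r ≤ s → s ≤ b → ∫ t in r..s, q t ≤ B * (s - r) + k)
    (hR : 0 ≤ R) (hη : B + η ≤ g R) (hu : IsMinimizer g q a b u) :
    IsDampedAbove u (forcePrimitive g q u a) a b R (2 * |B| + k) k η := by
  have hu_cont := H10.continuousOn hab hu.1.1
  have hQ_cont := continuousOn_forcePrimitive hab hg hq hu_cont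
  refine ⟨hu_cont, hQ_cont, hu.1.2, fun x y z hax hxy hyz hzb => ?_,
    fun r s har hrs hsb hlen => ?_, fun r s har hrs hsb hlarge => ?_⟩
  · have hslope := (hu.concaveOn_residual hab hg hmono hq).slope_anti_adjacent
      ⟨hax, by linarith⟩ ⟨by linarith, hzb⟩ hxy hyz
    have hQ := intervalIntegrable_of_continuousOn_Icc hab hQ_cont
    rw [← integral_interval_sub_Icc hQ ⟨hax, by linarith⟩ ⟨by linarith, by linarith⟩,
      ← integral_interval_sub_Icc hQ ⟨by linarith, by linarith⟩ ⟨by linarith, hzb⟩]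
    simpa only [residual, sub_sub_sub_comm] using hslope
  · have hle := forcePrimitive_sub_le (γ := 0) har hrs hsb hg hq hu_cont (hmean r s har hrs hsb)
      fun t ht => by
      have hut := hu.1.2 t ⟨har.trans ht.1, ht.2.trans hsb⟩
      exact hg0 ▸ hmono self_mem_Ici hut hut
    have := mul_le_mul_of_nonneg_right (le_abs_self B) (sub_nonneg.2 hrs)
    have := mul_le_mul_of_nonneg_left (sub_le_iff_le_add'.2 hlen) (abs_nonneg B)
    linarith
  · have hle := forcePrimitive_sub_le har hrs hsb hg hq hu_cont (hmean r s har hrs hsb) fun t ht =>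
      hmono hR (hu.1.2 t ⟨har.trans ht.1, ht.2.trans hsb⟩) (hlarge t ht)
    have := mul_le_mul_of_nonneg_right hη (sub_nonneg.2 hrs)
    linarith

end MinimizerBound

section Energy

variable {g q u : ℝ → ℝ} {a b c d m x y B C R k M H η : ℝ}

lemma action_add_const_mul_tent_sub (hac : a ≤ c) (hcm : c < m) (hmd : m < d) (hdb : d ≤ b)
    (hg : Continuous g) (hq : IntervalIntegrable q volume a b) (hu : u ∈ H10 a b) (H : ℝ) :
    action g q a b (fun t => u t + H * tent c m d t) - action g q a b u =
      H * ((u m - u c) / (m - c) - (u d - u m) / (d - m)) +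
        (1 / 2) * (H ^ 2 * (1 / (m - c) + 1 / (d - m))) -
        (∫ t in c..d, (primitiveG g (u t + H * tent c m d t) - primitiveG g (u t))) +
        H * ∫ t in a..b, q t * tent c m d t := by
  have hab : a ≤ b := by linarith
  have hsupport : (fun t => primitiveG g (u t + H * tent c m d t) - primitiveG g (u t)).support ⊆
      Ioc c d := by
    intro t ht
    by_contra hmem
    refine ht ?_
    have htent : tent c m d t = 0 := by
      rcases le_or_gt t c with htc | hct
      · exact tent_of_le hcm htc
      · exact tent_of_ge hmd (le_of_not_ge fun htd => hmem ⟨hct, htd⟩)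
    simp only [htent, mul_zero, add_zero, sub_self]
  have hlocal := (intervalIntegral.integral_eq_integral_of_support_subset (μ := volume)
    (hsupport.trans (Ioc_subset_Ioc hac hdb))).trans
    (intervalIntegral.integral_eq_integral_of_support_subset hsupport).symm
  rw [action_add_sub hab hg hq hu (H10.const_mul_mem (tent_mem_H10 hac hcm hmd hdb) H), hlocal,
    ← integral_deriv_mul_deriv_tent hac hcm hmd hdb hu.1,
    ← integral_deriv_tent_sq hac hcm hmd hdb]
  simp only [deriv_const_mul_field, mul_left_comm _ H, mul_pow,
    intervalIntegral.integral_const_mul]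

lemma mul_sub_le_primitiveG_add_sub (hg : Continuous g) (hg0 : g 0 = 0)
    (hmono : MonotoneOn g (Ici 0)) (hC : ∀ s, 0 ≤ s → |g s| ≤ C) (hR : 0 ≤ R)
    (hx : x ∈ Icc 0 M) (hy : 0 ≤ y) :
    g R * y - (g R * R + C * M) ≤ primitiveG g (x + y) - primitiveG g x := by
  have hR_le := mul_sub_le_primitiveG_sub hg hmono hR (add_nonneg hx.1 hy)
  have hR_nonneg := mul_sub_le_primitiveG_sub hg hmono le_rfl hR
  have hx_le := (le_abs_self _).trans (abs_primitiveG_sub_le hg hC le_rfl hx.1)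
  have hgR : 0 ≤ g R := hg0 ▸ hmono self_mem_Ici hR hR
  have hC_nonneg : 0 ≤ C := (abs_nonneg _).trans (hC 0 le_rfl)
  rw [hg0, zero_mul] at hR_nonneg
  rw [sub_zero, abs_of_nonneg hx.1] at hx_le
  linarith [mul_le_mul_of_nonneg_left hx.2 hC_nonneg, mul_nonneg hgR hx.1]

lemma le_integral_primitiveG_add_tent_sub (hcm : c < m) (hmd : m < d) (hg : Continuous g)
    (hg0 : g 0 = 0) (hmono : MonotoneOn g (Ici 0)) (hC : ∀ s, 0 ≤ s → |g s| ≤ C)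
    (hu_cont : ContinuousOn u (Icc c d)) (hu : ∀ t ∈ Icc c d, u t ∈ Icc 0 M)
    (hR : 0 ≤ R) (hH : 0 ≤ H) :
    g R * H * ((d - c) / 2) - (g R * R + C * M) * (d - c) ≤
      ∫ t in c..d, (primitiveG g (u t + H * tent c m d t) - primitiveG g (u t)) := by
  have hcd : c ≤ d := (hcm.trans hmd).le
  have htent_cont := H10.continuousOn hcd (tent_mem_H10 le_rfl hcm hmd le_rfl)
  have hG := continuous_primitiveG hg
  have htent_int := (intervalIntegrable_of_continuousOn_Icc hcd htent_cont).const_mul (g R * H)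
  have hG_cont : ContinuousOn
      (fun t => primitiveG g (u t + H * tent c m d t) - primitiveG g (u t)) (Icc c d) := by
    fun_prop
  have hle := intervalIntegral.integral_mono_on hcd
    (htent_int.sub (intervalIntegrable_const (c := g R * R + C * M)))
    (intervalIntegrable_of_continuousOn_Icc hcd hG_cont) fun t ht => by
      rw [mul_assoc]
      exact mul_sub_le_primitiveG_add_sub hg hg0 hmono hC hR (hu t ht)
        (mul_nonneg hH (tent_nonneg c m d t))
  rw [intervalIntegral.integral_sub htent_int intervalIntegrable_const,
    intervalIntegral.integral_const_mul, integral_tent le_rfl hcm hmd le_rfl,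
    intervalIntegral.integral_const, smul_eq_mul] at hle
  linarith

-- A minimizer bounded by `M` on `[c, d]` could be improved by adding a tent of height `H`, whose
-- potential gain `∫ (g(R) - q) H tent ≥ η H (d - c) / 2 - k H` outgrows the remaining terms.
lemma IsMinimizer.length_le_of_le (hac : a ≤ c) (hdb : d ≤ b) (hcd : 1 ≤ d - c)
    (hg : Continuous g) (hg0 : g 0 = 0) (hmono : MonotoneOn g (Ici 0))
    (hC : ∀ s, 0 ≤ s → |g s| ≤ C) (hq : IntervalIntegrable q volume a b)
    (hmean : ∀ r s, a ≤ r → r ≤ s → s ≤ b → ∫ t in r..s, q t ≤ B * (s - r) + k)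
    (hu : IsMinimizer g q a b u) (hM : ∀ t ∈ Icc c d, u t ≤ M) (hR : 0 ≤ R) (hH : 0 ≤ H)
    (hη : B + η ≤ g R) (hgain : g R * R + C * M + 1 ≤ η * H / 2) :
    d - c ≤ 4 * H * M + 2 * H ^ 2 + k * H := by
  obtain ⟨m, hm⟩ : ∃ m, m = (c + d) / 2 := ⟨_, rfl⟩
  have hcm : c < m := by linarith
  have hmd : m < d := by linarith
  have hu_mem : ∀ t ∈ Icc c d, u t ∈ Icc 0 M := fun t ht =>
    ⟨hu.1.2 t ⟨hac.trans ht.1, ht.2.trans hdb⟩, hM t ht⟩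
  have hmin : action g q a b u ≤ action g q a b (fun t => u t + H * tent c m d t) :=
    hu.2 (show _ ∈ H10plus a b from
      ⟨H10.add_mem (by linarith) hu.1.1 (H10.const_mul_mem (tent_mem_H10 hac hcm hmd hdb) H),
        fun t ht => add_nonneg (hu.1.2 t ht) (mul_nonneg hH (tent_nonneg c m d t))⟩)
  have hact := action_add_const_mul_tent_sub hac hcm hmd hdb hg hq hu.1.1 H
  have hG := le_integral_primitiveG_add_tent_sub hcm hmd hg hg0 hmono hC
    ((H10.continuousOn (by linarith) hu.1.1).mono (Icc_subset_Icc hac hdb)) hu_mem hR hH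
  have hq_tent := mul_le_mul_of_nonneg_left (integral_mul_tent_le hac hcm hmd hdb hq hmean) hH
  have hkink : (u m - u c) / (m - c) - (u d - u m) / (d - m) ≤ 4 * M := by
    rw [show d - m = m - c by linarith, ← sub_div, div_le_iff₀ (by linarith)]
    have huc := (hu_mem c ⟨le_rfl, by linarith⟩).1
    have hud := (hu_mem d ⟨by linarith, le_rfl⟩).1
    have hum := hu_mem m ⟨hcm.le, hmd.le⟩
    have hM_le : 2 * M ≤ 4 * M * (m - c) := by
      linarith [mul_nonneg (hum.1.trans hum.2) (show 0 ≤ 4 * (m - c) - 2 by linarith)]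
    linarith [hum.2]
  have hkinetic : 1 / (m - c) + 1 / (d - m) ≤ 4 := by
    rw [show d - m = m - c by linarith, ← add_div, div_le_iff₀ (by linarith)]
    linarith
  have hη_mul := mul_le_mul_of_nonneg_right hη (show 0 ≤ H * ((d - c) / 2) by nlinarith)
  have hgain_mul := mul_le_mul_of_nonneg_right hgain (show 0 ≤ d - c by linarith)
  linarith [mul_le_mul_of_nonneg_left hkink hH, mul_le_mul_of_nonneg_left hkinetic (sq_nonneg H)]

end Energy

section Positivity

variable {g : ℝ → ℝ} {B C : ℝ}

lemma exists_forall_isMinimizer_pos (hg : Continuous g) (hg0 : g 0 = 0)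
    (hmono : MonotoneOn g (Ici 0)) (hC : ∀ s, 0 ≤ s → |g s| ≤ C) (hB : ∃ R, 0 < R ∧ B < g R)
    (k : ℝ) :
    ∃ L, ∀ (q : ℝ → ℝ) (a b : ℝ), L ≤ b - a → IntervalIntegrable q volume a b →
      (∀ r s, a ≤ r → r ≤ s → s ≤ b → ∫ t in r..s, q t ≤ B * (s - r) + k) →
      ∀ u, IsMinimizer g q a b u → ∀ t ∈ Ioo a b, 0 < u t := by
  obtain ⟨R, hR, hBR⟩ := hB
  obtain ⟨η, hη⟩ : ∃ η, η = g R - B := ⟨_, rfl⟩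
  have hη_pos : 0 < η := by linarith
  have hη_le : B + η ≤ g R := by linarith
  set M := R + (R + (2 * |B| + k) + k) ^ 2 / (2 * η)
  set H := 2 * |g R * R + C * M + 1| / η
  have hH : 0 ≤ H := by positivity
  have hgain : g R * R + C * M + 1 ≤ η * H / 2 := by
    rw [mul_div_cancel₀ _ hη_pos.ne', mul_div_cancel_left₀ _ two_ne_zero]
    exact le_abs_self _
  set ℓ := 4 * H * M + 2 * H ^ 2 + k * H
  refine ⟨2 * (|ℓ| + 1), fun q a b hL hq hmean u hu t₀ ht₀ => ?_⟩
  by_contra hneg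
  have hzero : u t₀ = 0 := le_antisymm (not_lt.1 hneg) (hu.1.2 t₀ (Ioo_subset_Icc_self ht₀))
  have hdamped := hu.isDampedAbove (ht₀.1.trans ht₀.2).le hg hg0 hmono hq hmean hR.le hη_le
  have hshort : ∀ c d, a ≤ c → d ≤ b → 1 ≤ d - c → (∀ t ∈ Icc c d, u t ≤ M) → d - c ≤ ℓ :=
    fun c d hac hdb hcd hM => hu.length_le_of_le hac hdb hcd hg hg0 hmono hC hq hmean hM hR.le hH
      hη_le hgain
  have hℓ := le_abs_self ℓ
  have hℓ_nonneg := abs_nonneg ℓ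
  rcases le_total ((a + b) / 2) t₀ with hright | hleft
  · have := hshort a t₀ le_rfl ht₀.2.le (by linarith) fun t ht =>
      hdamped.le_of_zero_right hη_pos hR ht₀.2 hzero ht
    linarith
  · have := hshort t₀ b ht₀.1.le le_rfl (by linarith) fun t ht =>
      hdamped.le_of_zero_left hη_pos hR ht₀.1 hzero ht
    linarith

end Positivity

section Decomposition

/-- A uniform one-sided bound on the means of the forcing terms in `𝒬`: up to an additive
constant, the integral over an interval is at most `B < γ` times its length. The class `𝒫` has this
property for each `γ > A(p)`. -/
def HasUpperMeansBelow (γ : ℝ) (𝒬 : Set (ℝ → ℝ)) : Prop :=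
  ∃ B < γ, ∃ k, ∀ q ∈ 𝒬, (∀ a b, IntervalIntegrable q volume a b) ∧
    ∀ r s, r ≤ s → ∫ t in r..s, q t ≤ B * (s - r) + k

variable {f p q q₁ q₂ : ℝ → ℝ} {p₂ : ℝ → ℝ → ℝ} {r s A ε K γ : ℝ}

lemma ae_abs_le_toReal_of_eLpNorm_top_le {c : ENNReal} (hc : c ≠ ⊤)
    (hf : eLpNorm f ⊤ volume ≤ c) : ∀ᵐ t, |f t| ≤ c.toReal := by
  rw [eLpNorm_exponent_top] at hf
  filter_upwards [ae_le_eLpNormEssSup (f := f) (μ := volume)] with t ht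
  have h := ENNReal.toReal_mono hc (ht.trans hf)
  rwa [toReal_enorm, Real.norm_eq_abs] at h

lemma intervalIntegrable_of_memLp_top (hf : MemLp f ⊤ volume) (a b : ℝ) :
    IntervalIntegrable f volume a b :=
  ((hf.locallyIntegrable le_top).integrableOn_isCompact isCompact_uIcc).intervalIntegrable

lemma abs_le_of_ae_abs_le (hf : Continuous f) (h : ∀ᵐ t, |f t| ≤ K) (t : ℝ) : |f t| ≤ K :=
  (isClosed_le hf.abs continuous_const).closure_subset (Measure.dense_of_ae h t)

namespace IsDecomposition

lemma ae_abs_sub_le (h : IsDecomposition q A ε q₁ q₂) (hε : 0 ≤ ε) :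
    ∀ᵐ t, |q₁ t - A| ≤ ε / 2 := by
  have hle := ae_abs_le_toReal_of_eLpNorm_top_le ENNReal.ofReal_ne_top h.norm_fst.le
  rwa [ENNReal.toReal_ofReal (by linarith)] at hle

lemma intervalIntegrable_fst (h : IsDecomposition q A ε q₁ q₂) (a b : ℝ) :
    IntervalIntegrable q₁ volume a b := by
  have hsub : MemLp (fun t => q₁ t - A) ⊤ volume :=
    ⟨h.measurable_fst.sub aestronglyMeasurable_const, h.norm_fst.trans ENNReal.ofReal_lt_top⟩
  simpa only [sub_add_cancel] using
    (intervalIntegrable_of_memLp_top hsub a b).add (intervalIntegrable_const (c := A))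

lemma continuous_snd (h : IsDecomposition q A ε q₁ q₂)
    (hq : ∀ a b, IntervalIntegrable q volume a b) : Continuous q₂ := by
  have hq₂ : q₂ = fun t => q₂ 0 + ∫ x in (0 : ℝ)..t, (q x - q₁ x) :=
    funext fun t => by rw [← h.primitive 0 t, add_sub_cancel]
  rw [hq₂]
  exact continuous_const.add (intervalIntegral.continuous_primitive
    (fun a b => (hq a b).sub (h.intervalIntegrable_fst a b)) 0)

lemma integral_le (h : IsDecomposition q A ε q₁ q₂) (hε : 0 ≤ ε)
    (hq : ∀ a b, IntervalIntegrable q volume a b) (hK : ∀ t, |q₂ t| ≤ K) (hrs : r ≤ s) :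
    ∫ t in r..s, q t ≤ (A + ε / 2) * (s - r) + 2 * K := by
  have hq₁ := h.intervalIntegrable_fst r s
  have hprimitive := h.primitive r s
  rw [intervalIntegral.integral_sub (hq r s) hq₁] at hprimitive
  have hmean : ∫ t in r..s, q₁ t ≤ ∫ _ in r..s, (A + ε / 2) := by
    refine intervalIntegral.integral_mono_ae hrs hq₁ intervalIntegrable_const ?_
    filter_upwards [h.ae_abs_sub_le hε] with t ht
    linarith [le_of_abs_le ht]
  rw [intervalIntegral.integral_const, smul_eq_mul] at hmean
  linarith [neg_le_of_abs_le (hK r), le_of_abs_le (hK s)]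

end IsDecomposition

lemma hasUpperMeansBelow_classP (hA : A < γ)
    (hp₂ : ∀ ε ∈ Ioo (0 : ℝ) 1, MemLp (p₂ ε) ⊤ volume) :
    HasUpperMeansBelow γ (classP p A p₂) := by
  obtain ⟨ε, hε, hεγ⟩ := exists_between (lt_min one_pos (sub_pos.2 hA))
  obtain ⟨hε_one, hε_lt⟩ := lt_min_iff.1 hεγ
  set c := eLpNorm (p₂ ε) ⊤ volume + 1
  have hc : c ≠ ⊤ :=
    ENNReal.add_ne_top.2 ⟨(hp₂ ε ⟨hε, hε_one⟩).eLpNorm_ne_top, ENNReal.one_ne_top⟩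
  refine ⟨A + ε / 2, by linarith, 2 * c.toReal, fun q hq => ?_⟩
  obtain ⟨hq_top, -, -, hdec⟩ := hq
  have hq_int := intervalIntegrable_of_memLp_top hq_top
  obtain ⟨q₁, q₂, h, hq₂⟩ := hdec ε ⟨hε, hε_one⟩
  exact ⟨hq_int, fun r s hrs => h.integral_le hε.le hq_int
    (abs_le_of_ae_abs_le (h.continuous_snd hq_int)
      (ae_abs_le_toReal_of_eLpNorm_top_le hc hq₂.le)) hrs⟩

end Decomposition

section DirectMethod

variable {H E : Type*} [NormedAddCommGroup H] [InnerProductSpace ℝ H] [NormedAddCommGroup E]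
  [NormedSpace ℝ E] {T : H →L[ℝ] E} {F : E → ℝ} {κ : NNReal} {K : Set H} {m : ℝ}

lemma exists_norm_sq_sub_le_half_norm_sq_add_comp (hF : LipschitzOnWith κ F (T '' K)) :
    ∃ c, ∀ x ∈ K, (1 / 4) * ‖x‖ ^ 2 - c ≤ (1 / 2) * ‖x‖ ^ 2 + F (T x) := by
  rcases K.eq_empty_or_nonempty with rfl | ⟨x₀, hx₀⟩
  · exact ⟨0, fun x hx => hx.elim⟩
  refine ⟨(κ * ‖T‖) ^ 2 + κ * ‖T‖ * ‖x₀‖ - F (T x₀), fun x hx => ?_⟩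
  have hdist : |F (T x) - F (T x₀)| ≤ κ * ‖T x - T x₀‖ := by
    rw [← Real.dist_eq, ← dist_eq_norm]
    exact hF.dist_le_mul _ (mem_image_of_mem T hx) _ (mem_image_of_mem T hx₀)
  have hT : κ * ‖T x - T x₀‖ ≤ κ * (‖T‖ * (‖x‖ + ‖x₀‖)) := by
    gcongr
    rw [← map_sub]
    exact (T.le_opNorm _).trans (by gcongr; exact norm_sub_le x x₀)
  linarith [neg_le_of_abs_le hdist, sq_nonneg (‖x‖ / 2 - κ * ‖T‖)]

lemma quarter_norm_sub_sq_le (hF : LipschitzOnWith κ F (T '' K)) (hK : Convex ℝ K)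
    (hm : ∀ x ∈ K, m ≤ (1 / 2) * ‖x‖ ^ 2 + F (T x)) {x y : H} (hx : x ∈ K) (hy : y ∈ K) :
    (1 / 4) * ‖x - y‖ ^ 2 ≤ ((1 / 2) * ‖x‖ ^ 2 + F (T x) - m) +
      ((1 / 2) * ‖y‖ ^ 2 + F (T y) - m) + κ * ‖T x - T y‖ := by
  obtain ⟨z, hz⟩ : ∃ z, z = midpoint ℝ x y := ⟨_, rfl⟩
  have hzK : z ∈ K := hz ▸ hK.midpoint_mem hx hy
  have hz_norm : ‖z‖ = (1 / 2) * ‖x + y‖ := by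
    rw [hz, midpoint_eq_smul_add, norm_smul, invOf_eq_inv, norm_inv, Real.norm_ofNat, one_div]
  have hTz : T z = midpoint ℝ (T x) (T y) := by
    rw [hz, midpoint_eq_smul_add, midpoint_eq_smul_add, map_smul, map_add]
  have hdist : ∀ w ∈ K, F (T z) - F (T w) ≤ κ * dist (T z) (T w) := fun w hw =>
    (le_abs_self _).trans
      (hF.dist_le_mul _ (mem_image_of_mem T hzK) _ (mem_image_of_mem T hw))
  have hdist_x := hdist x hx
  have hdist_y := hdist y hy
  rw [hTz, dist_midpoint_left, dist_eq_norm, ← hTz, Real.norm_ofNat] at hdist_x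
  rw [hTz, dist_midpoint_right, dist_eq_norm, ← hTz, Real.norm_ofNat] at hdist_y
  have hmz := hm z hzK
  rw [hz_norm] at hmz
  linarith [parallelogram_law_with_norm ℝ x y]

lemma exists_subseq_cauchySeq (hT : IsCompactOperator T) (hF : LipschitzOnWith κ F (T '' K))
    (hK : Convex ℝ K) (hm : ∀ x ∈ K, m ≤ (1 / 2) * ‖x‖ ^ 2 + F (T x)) {x : ℕ → H}
    (hx : ∀ n, x n ∈ K)
    (hlim : Tendsto (fun n => (1 / 2) * ‖x n‖ ^ 2 + F (T (x n))) atTop (𝓝 m)) :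
    ∃ φ : ℕ → ℕ, StrictMono φ ∧ CauchySeq (x ∘ φ) := by
  obtain ⟨c, hc⟩ := exists_norm_sq_sub_le_half_norm_sq_add_comp hF
  obtain ⟨N, hN⟩ := hlim.bddAbove_range
  have hbound : ∀ n, x n ∈ Metric.closedBall (0 : H) (√(4 * (N + c))) := fun n => by
    rw [mem_closedBall_zero_iff]
    exact Real.le_sqrt_of_sq_le (by linarith [hc _ (hx n), hN (mem_range_self n)])
  obtain ⟨e, -, φ, hφ, he⟩ := (hT.isCompact_closure_image_closedBall _).tendsto_subseq
    fun n => subset_closure (mem_image_of_mem T (hbound n))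
  refine ⟨φ, hφ, cauchySeq_iff_tendsto_dist_atTop_0.2 ?_⟩
  have hdist := cauchySeq_iff_tendsto_dist_atTop_0.1 he.cauchySeq
  rw [← prod_atTop_atTop_eq] at hdist ⊢
  have hJ := (hlim.comp hφ.tendsto_atTop).sub_const m
  rw [sub_self] at hJ
  have hsqrt := ((((hJ.comp tendsto_fst).add (hJ.comp tendsto_snd)).add
    (hdist.const_mul (κ : ℝ))).const_mul 4).sqrt
  simp only [mul_zero, add_zero, Real.sqrt_zero] at hsqrt
  refine squeeze_zero (fun _ => dist_nonneg) (fun n => Real.le_sqrt_of_sq_le ?_) hsqrt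
  have hquarter := quarter_norm_sub_sq_le hF hK hm (hx (φ n.1)) (hx (φ n.2))
  simp only [Function.comp_apply, dist_eq_norm]
  linarith

lemma exists_isMinOn_half_norm_sq_add_comp [CompleteSpace H] (hT : IsCompactOperator T)
    (hF : LipschitzOnWith κ F (T '' K)) (hclosed : IsClosed K) (hconv : Convex ℝ K)
    (hne : K.Nonempty) : ∃ x ∈ K, IsMinOn (fun x => (1 / 2) * ‖x‖ ^ 2 + F (T x)) K x := by
  set J : H → ℝ := fun x => (1 / 2) * ‖x‖ ^ 2 + F (T x)
  have hbdd : BddBelow (J '' K) := by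
    obtain ⟨c, hc⟩ := exists_norm_sq_sub_le_half_norm_sq_add_comp hF
    exact ⟨-c, forall_mem_image.2 fun x hx =>
      le_trans (by linarith [sq_nonneg ‖x‖]) (hc x hx)⟩
  have hJ_cont : ContinuousOn J K := by
    have hFT := hF.continuousOn.comp T.continuous.continuousOn (mapsTo_image T K)
    exact (continuous_norm.pow 2).continuousOn.const_mul _ |>.add hFT
  have hm : ∀ x ∈ K, sInf (J '' K) ≤ J x := fun x hx => csInf_le hbdd (mem_image_of_mem J hx)
  obtain ⟨j, -, hlim, hj⟩ := exists_seq_tendsto_sInf (hne.image J) hbdd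
  choose x hxK hxj using hj
  obtain rfl : J ∘ x = j := funext hxj
  obtain ⟨φ, hφ, hcauchy⟩ := exists_subseq_cauchySeq hT hF hconv hm hxK hlim
  obtain ⟨x₀, hx₀⟩ := cauchySeq_tendsto_of_complete hcauchy
  have hx₀K : x₀ ∈ K := hclosed.mem_of_tendsto hx₀ (Eventually.of_forall fun n => hxK _)
  have hJx₀ : Tendsto (J ∘ x ∘ φ) atTop (𝓝 (J x₀)) :=
    (hJ_cont x₀ hx₀K).tendsto.comp
      (tendsto_nhdsWithin_iff.2 ⟨hx₀, Eventually.of_forall fun n => hxK _⟩)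
  have hinf : J x₀ = sInf (J '' K) := tendsto_nhds_unique hJx₀ (hlim.comp hφ.tendsto_atTop)
  exact ⟨x₀, hx₀K, fun y hy => hinf.trans_le (hm y hy)⟩

end DirectMethod

section Volterra

variable {a b s t : ℝ}

/-- The Hilbert space `L²(a, b)`, in which the derivatives of the functions in `H¹₀(a, b)` live. -/
abbrev L2Ioc (a b : ℝ) := Lp ℝ 2 (volume.restrict (Ioc a b))

namespace L2Ioc

lemma intervalIntegrable (f : L2Ioc a b) (has : a ≤ s) (hst : s ≤ t) (htb : t ≤ b) :
    IntervalIntegrable f volume s t := by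
  rw [intervalIntegrable_iff_integrableOn_Ioc_of_le hst]
  have hf : IntegrableOn f (Ioc a b) volume := (Lp.memLp f).integrable one_le_two
  exact hf.mono_set (Ioc_subset_Ioc has htb)

lemma abs_integral_le (f : L2Ioc a b) (has : a ≤ s) (hst : s ≤ t) (htb : t ≤ b) :
    |∫ r in s..t, f r| ≤ √(t - s) * ‖f‖ := by
  have hinner := L2.inner_indicatorConstLp_one (𝕜 := ℝ) (s := Ioc s t) measurableSet_Ioc
    (measure_ne_top (volume.restrict (Ioc a b)) _) f
  have hinter : Ioc s t ∩ Ioc a b = Ioc s t := inter_eq_left.2 (Ioc_subset_Ioc has htb)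
  rw [Measure.restrict_restrict measurableSet_Ioc, hinter,
    ← intervalIntegral.integral_of_le hst] at hinner
  rw [← hinner]
  refine (abs_real_inner_le_norm _ _).trans_eq ?_
  rw [norm_indicatorConstLp two_ne_zero ENNReal.ofNat_ne_top, Measure.real,
    Measure.restrict_apply measurableSet_Ioc, hinter, Real.volume_Ioc,
    ENNReal.toReal_ofReal (sub_nonneg.2 hst), ENNReal.toReal_ofNat, ← Real.sqrt_eq_rpow,
    norm_one, one_mul]

lemma abs_integral_sub_le (f : L2Ioc a b) (hs : s ∈ Icc a b) (ht : t ∈ Icc a b) :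
    |(∫ r in a..s, f r) - ∫ r in a..t, f r| ≤ √|s - t| * ‖f‖ := by
  wlog hts : t ≤ s generalizing s t
  · rw [abs_sub_comm, abs_sub_comm s]
    exact this ht hs (le_of_not_ge hts)
  rw [intervalIntegral.integral_interval_sub_left (intervalIntegrable f le_rfl hs.1 hs.2)
    (intervalIntegrable f le_rfl ht.1 ht.2), abs_of_nonneg (sub_nonneg.2 hts)]
  exact abs_integral_le f ht.1 hts hs.2

lemma continuous_integral (f : L2Ioc a b) :
    Continuous fun t : Icc a b => ∫ r in a..(t : ℝ), f r := by
  refine continuous_iff_continuousAt.2 fun s => tendsto_iff_norm_sub_tendsto_zero.2 ?_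
  have hmodulus : Continuous fun t : Icc a b => √|(t : ℝ) - s| * ‖f‖ := by fun_prop
  exact squeeze_zero (fun _ => norm_nonneg _) (fun t => abs_integral_sub_le f t.2 s.2)
    (by simpa only [sub_self, abs_zero, Real.sqrt_zero, zero_mul] using hmodulus.tendsto s)

end L2Ioc

lemma integral_congr_ae_restrict_Ioc {f h : ℝ → ℝ} (hat : a ≤ t) (htb : t ≤ b)
    (hfh : f =ᵐ[volume.restrict (Ioc a b)] h) : ∫ r in a..t, f r = ∫ r in a..t, h r := by
  refine intervalIntegral.integral_congr_ae_restrict ?_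
  rw [uIoc_of_le hat]
  exact ae_restrict_of_ae_restrict_of_subset (Ioc_subset_Ioc_right htb) hfh

/-- The Volterra operator `f ↦ ∫ₐᵗ f`, which recovers a function in `H¹₀(a, b)` from its
derivative. -/
def volterra (a b : ℝ) : L2Ioc a b →L[ℝ] BoundedContinuousFunction (Icc a b) ℝ :=
  LinearMap.mkContinuous
    { toFun := fun f => BoundedContinuousFunction.mkOfCompact ⟨_, L2Ioc.continuous_integral f⟩
      map_add' := fun f h => by
        ext t
        exact (integral_congr_ae_restrict_Ioc t.2.1 t.2.2 (Lp.coeFn_add f h)).trans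
          (intervalIntegral.integral_add (L2Ioc.intervalIntegrable f le_rfl t.2.1 t.2.2)
            (L2Ioc.intervalIntegrable h le_rfl t.2.1 t.2.2))
      map_smul' := fun c f => by
        ext t
        exact (integral_congr_ae_restrict_Ioc t.2.1 t.2.2 (Lp.coeFn_smul c f)).trans
          (intervalIntegral.integral_const_mul c f) }
    √(b - a) fun f => by
      refine (BoundedContinuousFunction.norm_le (by positivity)).2 fun t => ?_
      refine (L2Ioc.abs_integral_le f le_rfl t.2.1 t.2.2).trans ?_
      gcongr
      exact t.2.2

lemma volterra_apply (f : L2Ioc a b) (t : Icc a b) :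
    volterra a b f t = ∫ r in a..(t : ℝ), f r := rfl

lemma isCompactOperator_volterra (a b : ℝ) : IsCompactOperator (volterra a b) := by
  refine (isCompactOperator_iff_isCompact_closure_image_closedBall
    (volterra a b).toLinearMap one_pos).2 ?_
  refine BoundedContinuousFunction.arzela_ascoli (Metric.closedBall 0 ‖volterra a b‖)
    (isCompact_closedBall _ _) _ ?_ ?_
  · rintro _ t ⟨f, hf, rfl⟩
    rw [mem_closedBall_zero_iff] at hf ⊢
    exact (BoundedContinuousFunction.norm_coe_le_norm _ t).trans
      ((volterra a b).unit_le_opNorm f hf)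
  · refine Metric.equicontinuous_of_continuity_modulus Real.sqrt ?_ _ ?_
    · simpa only [Real.sqrt_zero] using Real.continuous_sqrt.tendsto 0
    · rintro s t ⟨_, f, hf, rfl⟩
      rw [mem_closedBall_zero_iff] at hf
      exact (L2Ioc.abs_integral_sub_le f s.2 t.2).trans
        (mul_le_of_le_one_right (Real.sqrt_nonneg _) hf)

end Volterra

section Feasible

variable {u : ℝ → ℝ} {a b : ℝ} {f : L2Ioc a b}

lemma H10.memLp_deriv_Ioc (hu : u ∈ H10 a b) :
    MemLp (deriv u) 2 (volume.restrict (Ioc a b)) := by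
  rw [← restrict_Ioo_eq_restrict_Ioc]
  exact hu.2.1

lemma volterra_eq_of_ae_eq_deriv (hu : u ∈ H10 a b)
    (hf : f =ᵐ[volume.restrict (Ioc a b)] deriv u) (t : Icc a b) : volterra a b f t = u t := by
  have hac : AbsolutelyContinuousOnInterval u a t :=
    hu.1.mono (by
      rw [uIcc_of_le t.2.1, uIcc_of_le (t.2.1.trans t.2.2)]
      exact Icc_subset_Icc_right t.2.2)
  rw [volterra_apply, integral_congr_ae_restrict_Ioc t.2.1 t.2.2 hf, hac.integral_deriv_eq_sub,
    hu.2.2.1, sub_zero]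

/-- The derivatives of the functions in `H¹₀(a, b)⁺`, as a subset of `L²(a, b)`, described through
their primitives. -/
def H10plusDeriv (hab : a ≤ b) : Set (L2Ioc a b) :=
  {f | (∀ t, 0 ≤ volterra a b f t) ∧ volterra a b f ⟨b, right_mem_Icc.2 hab⟩ = 0}

lemma isClosed_H10plusDeriv (hab : a ≤ b) : IsClosed (H10plusDeriv hab) := by
  have heval : ∀ t : Icc a b, Continuous fun f : L2Ioc a b => volterra a b f t := fun t =>
    (continuous_eval_const t).comp (volterra a b).continuous
  simp only [H10plusDeriv, ofPred_and, ofPred_forall]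
  exact (isClosed_iInter fun t => isClosed_le continuous_const (heval t)).inter
    (isClosed_eq (heval _) continuous_const)

lemma convex_H10plusDeriv (hab : a ≤ b) : Convex ℝ (H10plusDeriv hab) := by
  intro f hf h hh α β hα hβ _
  have hcomb : ∀ t, volterra a b (α • f + β • h) t =
      α * volterra a b f t + β * volterra a b h t := fun t => by
    rw [map_add, map_smul, map_smul]
    rfl
  refine ⟨fun t => ?_, ?_⟩
  · rw [hcomb]
    exact add_nonneg (mul_nonneg hα (hf.1 t)) (mul_nonneg hβ (hh.1 t))
  · rw [hcomb, hf.2, hh.2, mul_zero, mul_zero, add_zero]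

lemma zero_mem_H10plusDeriv (hab : a ≤ b) : 0 ∈ H10plusDeriv hab := by
  simp only [H10plusDeriv, mem_ofPred_eq, map_zero, BoundedContinuousFunction.coe_zero,
    Pi.zero_apply, le_refl, implies_true, and_self]

lemma mem_H10plusDeriv_of_ae_eq_deriv (hab : a ≤ b) (hu : u ∈ H10plus a b)
    (hf : f =ᵐ[volume.restrict (Ioc a b)] deriv u) : f ∈ H10plusDeriv hab := by
  refine ⟨fun t => ?_, ?_⟩ <;> rw [volterra_eq_of_ae_eq_deriv hu.1 hf]
  · exact hu.2 t t.2
  · exact hu.1.2.2.2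

lemma exists_mem_H10plus_ae_eq_deriv (hab : a ≤ b) (hf : f ∈ H10plusDeriv hab) :
    ∃ u ∈ H10plus a b, f =ᵐ[volume.restrict (Ioc a b)] deriv u := by
  have hf_int := L2Ioc.intervalIntegrable f le_rfl hab le_rfl
  have hderiv : f =ᵐ[volume.restrict (Ioc a b)] deriv fun t => ∫ r in a..t, f r := by
    refine (ae_restrict_iff' measurableSet_Ioc).2 ?_
    filter_upwards [hf_int.ae_hasDerivAt_integral] with t ht hmem
    rw [uIcc_of_le hab] at ht
    exact (ht (Ioc_subset_Icc_self hmem) a (left_mem_Icc.2 hab)).deriv.symm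
  refine ⟨_, ⟨⟨hf_int.absolutelyContinuousOnInterval_intervalIntegral left_mem_uIcc, ?_,
    intervalIntegral.integral_same, hf.2⟩, fun t ht => hf.1 ⟨t, ht⟩⟩, hderiv⟩
  rw [restrict_Ioo_eq_restrict_Ioc]
  exact (Lp.memLp f).ae_eq hderiv

end Feasible

section Existence

variable {g q u : ℝ → ℝ} {a b C : ℝ} {f : L2Ioc a b}

/-- The part of the action that does not involve the derivative, as a functional on continuous
functions on `[a, b]`. -/
def potential (g q : ℝ → ℝ) (hab : a ≤ b) (e : BoundedContinuousFunction (Icc a b) ℝ) : ℝ :=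
  ∫ t in a..b, (-primitiveG g (IccExtend hab e t) + q t * IccExtend hab e t)

lemma lipschitzOnWith_potential (hab : a ≤ b) (hg : Continuous g)
    (hC : ∀ s, 0 ≤ s → |g s| ≤ C) (hq : IntervalIntegrable q volume a b) :
    LipschitzOnWith (∫ t in a..b, (C + |q t|)).toNNReal (potential g q hab)
      {e | ∀ t, 0 ≤ e t} := by
  have hint : ∀ e : BoundedContinuousFunction (Icc a b) ℝ, IntervalIntegrable
      (fun t => -primitiveG g (IccExtend hab e t) + q t * IccExtend hab e t) volume a b :=
    fun e => (((continuous_primitiveG hg).comp e.continuous.Icc_extend').neg.intervalIntegrable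
      _ _).add (intervalIntegrable_mul_continuousOn hab hq e.continuous.Icc_extend'.continuousOn)
  refine LipschitzOnWith.of_dist_le' fun x hx y hy => ?_
  rw [dist_eq_norm, potential, potential, ← intervalIntegral.integral_sub (hint x) (hint y),
    ← intervalIntegral.integral_mul_const]
  refine intervalIntegral.norm_integral_le_of_norm_le hab (Eventually.of_forall fun t _ => ?_)
    ((intervalIntegrable_const.add hq.abs).mul_const _)
  simp only [IccExtend, Function.comp_apply]
  set w := projIcc a b hab t
  have hxy : |x w - y w| ≤ dist x y := x.dist_coe_le_dist w
  have hG : |primitiveG g (x w) - primitiveG g (y w)| ≤ C * dist x y :=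
    (abs_primitiveG_sub_le hg hC (hy w) (hx w)).trans
      (mul_le_mul_of_nonneg_left hxy ((abs_nonneg _).trans (hC 0 le_rfl)))
  have hqxy : |q t * (x w - y w)| ≤ |q t| * dist x y := by
    rw [abs_mul]
    gcongr
  calc ‖-primitiveG g (x w) + q t * x w - (-primitiveG g (y w) + q t * y w)‖
      = |q t * (x w - y w) - (primitiveG g (x w) - primitiveG g (y w))| := by
        rw [Real.norm_eq_abs]
        ring_nf
    _ ≤ (C + |q t|) * dist x y := by
      linarith [abs_sub (q t * (x w - y w)) (primitiveG g (x w) - primitiveG g (y w))]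

lemma action_eq_half_norm_sq_add_potential (hab : a ≤ b) (hg : Continuous g)
    (hq : IntervalIntegrable q volume a b) (hu : u ∈ H10 a b)
    (hf : f =ᵐ[volume.restrict (Ioc a b)] deriv u) :
    action g q a b u = (1 / 2) * ‖f‖ ^ 2 + potential g q hab (volterra a b f) := by
  have hu_cont := H10.continuousOn hab hu
  have hkinetic := (H10.intervalIntegrable_deriv_sq hab hu).const_mul (1 / 2)
  have hpotential : IntervalIntegrable (fun t => -primitiveG g (u t) + q t * u t) volume a b :=
    (intervalIntegrable_of_continuousOn_Icc hab
      ((continuous_primitiveG hg).comp_continuousOn hu_cont).neg).add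
      (intervalIntegrable_mul_continuousOn hab hq hu_cont)
  have hnorm : ‖f‖ ^ 2 = ∫ t in a..b, deriv u t ^ 2 := by
    rw [← real_inner_self_eq_norm_sq, L2.inner_def, intervalIntegral.integral_of_le hab]
    refine integral_congr_ae ?_
    filter_upwards [hf] with t ht
    rw [ht, real_inner_self_eq_norm_sq, Real.norm_eq_abs, sq_abs]
  have hvolterra : potential g q hab (volterra a b f) =
      ∫ t in a..b, (-primitiveG g (u t) + q t * u t) := by
    refine intervalIntegral.integral_congr fun t ht => ?_
    rw [uIcc_of_le hab] at ht
    simp only [IccExtend_of_mem hab _ ht, volterra_eq_of_ae_eq_deriv hu hf]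
  rw [hnorm, hvolterra, ← intervalIntegral.integral_const_mul,
    ← intervalIntegral.integral_add hkinetic hpotential, action]
  exact intervalIntegral.integral_congr fun t _ => by ring

theorem exists_isMinimizer (hab : a ≤ b) (hg : Continuous g) (hC : ∀ s, 0 ≤ s → |g s| ≤ C)
    (hq : IntervalIntegrable q volume a b) : ∃ u, IsMinimizer g q a b u := by
  have hlip := (lipschitzOnWith_potential hab hg hC hq).mono
    (image_subset_iff.2 fun (f : L2Ioc a b) (hf : f ∈ H10plusDeriv hab) => hf.1)
  obtain ⟨f, hf, hmin⟩ := exists_isMinOn_half_norm_sq_add_comp (isCompactOperator_volterra a b)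
    hlip (isClosed_H10plusDeriv hab) (convex_H10plusDeriv hab) ⟨0, zero_mem_H10plusDeriv hab⟩
  obtain ⟨u, hu, hfu⟩ := exists_mem_H10plus_ae_eq_deriv hab hf
  refine ⟨u, hu, fun v hv => ?_⟩
  have hv_ae := (H10.memLp_deriv_Ioc hv.1).coeFn_toLp
  rw [mem_ofPred_eq, action_eq_half_norm_sq_add_potential hab hg hq hu.1 hfu,
    action_eq_half_norm_sq_add_potential hab hg hq hv.1 hv_ae]
  exact hmin (mem_H10plusDeriv_of_ae_eq_deriv hab hv hv_ae)

end Existence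

section Limit

variable {g : ℝ → ℝ} {γ s : ℝ}

lemma abs_le_of_monotoneOn_of_tendsto (hg0 : g 0 = 0) (hmono : MonotoneOn g (Ici 0))
    (hγ : Tendsto g atTop (𝓝 γ)) (hs : 0 ≤ s) : |g s| ≤ γ := by
  rw [abs_of_nonneg (hg0 ▸ hmono self_mem_Ici hs hs)]
  exact ge_of_tendsto hγ ((eventually_ge_atTop s).mono fun r hr => hmono hs (hs.trans hr) hr)

end Limit

end BVP

end

theorem proposition4_general (g : ℝ → ℝ) (gp : ℝ) (hg : Continuous g) (hg0 : g 0 = 0)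
    (hmono : MonotoneOn g (Ici 0)) (hconc : StrictConcaveOn ℝ (Ioi 0) g)
    (hgp : Tendsto g atTop (𝓝 gp)) :
    (∀ 𝒬, BVP.HasUpperMeansBelow gp 𝒬 → ∀ L₀, ∃ L ≥ L₀, ∀ a b, L ≤ b - a → ∀ q ∈ 𝒬,
      (∃ u, BVP.IsMinimizer g q a b u) ∧
      (∀ u, BVP.IsMinimizer g q a b u →
        (∀ t ∈ Ioo a b, 0 < u t) ∧
        BVP.SolvesDirichlet g q a b u ∧
        (ContinuousOn q (Ioo a b) → BVP.SolvesDirichletClassically g q a b u)) ∧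
      (∀ u v, BVP.IsMinimizer g q a b u → BVP.IsMinimizer g q a b v → EqOn u v (Icc a b))) ∧
    (∀ q a b, a < b → IntervalIntegrable q volume a b → ∀ u v,
      (∀ t ∈ Ioo a b, 0 < u t) → (∀ t ∈ Ioo a b, 0 < v t) →
      BVP.IsMinimizer g q a b u → BVP.IsMinimizer g q a b v → EqOn u v (Icc a b)) := by
  have hC : ∀ s, 0 ≤ s → |g s| ≤ gp := fun s =>
    BVP.abs_le_of_monotoneOn_of_tendsto hg0 hmono hgp
  refine ⟨?_, fun q a b hab hq u v hu_pos hv_pos hu hv =>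
    hu.eqOn hab hg hmono hconc hq hv hu_pos hv_pos⟩
  rintro 𝒬 ⟨B, hB, k, h𝒬⟩ L₀
  have hR : ∃ R, 0 < R ∧ B < g R :=
    ((eventually_gt_atTop 0).and (hgp.eventually_const_lt hB)).exists
  obtain ⟨L, hL⟩ := BVP.exists_forall_isMinimizer_pos hg hg0 hmono hC hR k
  refine ⟨max L₀ (max L 1), le_max_left _ _, fun a b hLab q hq𝒬 => ?_⟩
  simp only [max_le_iff] at hLab
  obtain ⟨-, hLab, hab_one⟩ := hLab
  have hab : a < b := by linarith
  have hq : IntervalIntegrable q volume a b := (h𝒬 q hq𝒬).1 a b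
  have hpos := hL q a b hLab hq fun r s _ hrs _ => (h𝒬 q hq𝒬).2 r s hrs
  exact ⟨BVP.exists_isMinimizer hab.le hg hC hq,
    fun u hu => ⟨hpos u hu, hu.solvesDirichlet hab hg hmono hq (hpos u hu),
      hu.solvesDirichletClassically hab hg hmono hq (hpos u hu)⟩,
    fun u v hu hv => hu.eqOn hab hg hmono hconc hq hv (hpos u hu) (hpos v hv)⟩

theorem proposition4 (g : ℝ → ℝ) (gm gp : ℝ)
    (hg : BVP.AdmissibleNonlinearity g)
    (hgm : Tendsto g atBot (𝓝 gm)) (hgp : Tendsto g atTop (𝓝 gp))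
    (p : ℝ → ℝ) (A : ℝ) (hp : BVP.AdmissibleForcing gm gp p A) :
    -- existence, positivity and uniqueness on large intervals, uniformly in the class `𝒫`
    (∀ p₁ p₂ : ℝ → ℝ → ℝ,
      (∀ ε ∈ Ioo (0 : ℝ) 1, BVP.IsDecomposition p A ε (p₁ ε) (p₂ ε)) →
      ∀ L₀ > 0, ∃ L ≥ L₀, ∀ a b : ℝ, L ≤ b - a → ∀ q ∈ BVP.classP p A p₂,
        (∃ u, BVP.IsMinimizer g q a b u) ∧
        (∀ u, BVP.IsMinimizer g q a b u →
          (∀ t ∈ Ioo a b, 0 < u t) ∧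
          BVP.SolvesDirichlet g q a b u ∧
          (ContinuousOn q (Ioo a b) → BVP.SolvesDirichletClassically g q a b u)) ∧
        (∀ u v, BVP.IsMinimizer g q a b u → BVP.IsMinimizer g q a b v →
          EqOn u v (Icc a b))) ∧
    -- on an arbitrary interval, two positive `C²` minimizers coincide
    (∀ a b : ℝ, a < b → ∀ u v : ℝ → ℝ,
      ContDiffOn ℝ 2 u (Ioo a b) → ContDiffOn ℝ 2 v (Ioo a b) →
      (∀ t ∈ Ioo a b, 0 < u t) → (∀ t ∈ Ioo a b, 0 < v t) →
      BVP.IsMinimizer g p a b u → BVP.IsMinimizer g p a b v →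
      EqOn u v (Icc a b)) := by
  have h := proposition4_general g gp hg.contDiff.continuous hg.zero
    (hg.strictMono.monotone.monotoneOn _) hg.strictConcave hgp
  exact ⟨fun _ p₂ hdec L₀ _ => h.1 _
      (BVP.hasUpperMeansBelow_classP hp.upper fun ε hε => (hdec ε hε).memLp_snd) L₀,
    fun a b hab u v _ _ => h.2 p a b hab (hp.continuous.intervalIntegrable a b) u v⟩
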